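/- Let $n\in\mathbb N$, let $p,q\in(1,\infty)$ with $1/p+1/q=1$, let $\Omega\subseteq\mathbb R^n$ be nonempty, bounded and open, and let $\mathcal D_{\rm loc}\subseteq\mathbb R^{n\times n}\times\mathbb R^{n\times n}$ be an arbitrary set. For an open set $\omega\subseteq\mathbb R^n$ let $X_{p,q}(\omega)=L^p(\omega;\mathbb R^{n\times n})\times L^q(\omega;\mathbb R^{n\times n})$. A sequence $(F_k,P_k)$ in $X_{p,q}(\omega)$ is called div-curl-convergent to $(F,P)\in X_{p,q}(\omega)$ if it converges weakly to $(F,P)$ in $X_{p,q}(\omega)$ and, in addition, $\operatorname{curl}F_k\to\operatorname{curl}F$ strongly in $W^{-1,p}(\omega;\mathbb R^{n\times n\times n})$ and $\operatorname{div}P_k\to\operatorname{div}P$ strongly in $W^{-1,q}(\omega;\mathbb R^n)$. Here $(\operatorname{curl}F)_{ijk}=\partial_kF_{ij}-\partial_jF_{ik}$ and $(\operatorname{div}P)_i=\sum_j\partial_jP_{ij}$ in the sense of distributions, and $W^{-1,p}(\omega)$ is the dual of $W^{1,q}_0(\omega)$, $W^{-1,q}(\omega)$ the dual of $W^{1,p}_0(\omega)$.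 Let $$\mathcal D=\{(F,P)\in X_{p,q}(\Omega):\ (F(x),P(x))\in\mathcal D_{\rm loc}\text{ for a.e. }x\in\Omega\}.$$ Then the following are equivalent: 1. $\mathcal D$ is div-curl-closed, i.e. whenever a sequence in $\mathcal D$ is div-curl-convergent to some $(F,P)\in X_{p,q}(\Omega)$, then $(F,P)\in\mathcal D$. 2. $\mathcal D_{\rm loc}$ is locally $(p,q)$-div-curl-closed, i.e. for every bounded nonempty open set $\omega\subseteq\mathbb R^n$ and all $(F_*,P_*)\in\mathbb R^{n\times n}\times\mathbb R^{n\times n}$: if some sequence $(F_k,P_k)$ in $X_{p,q}(\omega)$ with $(F_k(x),P_k(x))\in\mathcal D_{\rm loc}$ for every $k$ and a.e. $x\in\omega$ is div-curl-convergent to the constant function $(F_*,P_*)$, then $(F_*,P_*)\in\mathcal D_{\rm loc}$. -/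

import Mathlib

open MeasureTheory TopologicalSpace Filter
open scoped ENNReal Topology

noncomputable section

namespace DivCurl

/-- The reference space `ℝⁿ` with its Euclidean norm. -/
abbrev Pt (n : ℕ) : Type := EuclideanSpace ℝ (Fin n)

/-- Real `n × n` matrices with the Euclidean (Frobenius) norm; the entry in row `i` and
column `j` of `A` is `A (i, j)`. -/
abbrev Mat (n : ℕ) : Type := EuclideanSpace ℝ (Fin n × Fin n)

/-- The space `ℝ^{n × n × n}` with its Euclidean norm; the entries of `A` are `A (i, j, k)`. -/
abbrev Tens (n : ℕ) : Type := EuclideanSpace ℝ (Fin n × Fin n × Fin n)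

/-- The phase space `X_{p,q}(Ω) = L^p(Ω; ℝ^{n × n}) × L^q(Ω; ℝ^{n × n})` (the product carries the
maximum of the two norms, which is equivalent to their sum). -/
abbrev PhaseSpace {n : ℕ} (p q : ℝ≥0∞) (Ω : Opens (Pt n)) : Type :=
  Lp (Mat n) p (volume.restrict (Ω : Set (Pt n))) ×
    Lp (Mat n) q (volume.restrict (Ω : Set (Pt n)))

/-- The partial derivative `∂_k φ (x)`. -/
def partialDeriv {n : ℕ} {V : Type*} [NormedAddCommGroup V] [NormedSpace ℝ V]
    (k : Fin n) (φ : Pt n → V) (x : Pt n) : V :=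
  fderiv ℝ φ x (EuclideanSpace.single k 1)

/-- The distributional row-wise curl `(curl F)_{ijk} = ∂_k F_{ij} - ∂_j F_{ik}` on `Ω`, acting on
test functions `φ ∈ C_c^∞(Ω; ℝ^{n × n × n})`. -/
def curl {n : ℕ} {Ω : Opens (Pt n)} (F : Pt n → Mat n) (φ : TestFunction Ω (Tens n) ⊤) : ℝ :=
  - ∫ x in (Ω : Set (Pt n)), ∑ i : Fin n, ∑ j : Fin n, ∑ k : Fin n,
      (F x (i, j) * partialDeriv k φ x (i, j, k) - F x (i, k) * partialDeriv j φ x (i, j, k))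

/-- The distributional row-wise divergence `(div P)_i = ∑ⱼ ∂_j P_{ij}` on `Ω`, acting on test
functions `φ ∈ C_c^∞(Ω; ℝⁿ)`. -/
def div {n : ℕ} {Ω : Opens (Pt n)} (P : Pt n → Mat n) (φ : TestFunction Ω (Pt n) ⊤) : ℝ :=
  - ∫ x in (Ω : Set (Pt n)), ∑ i : Fin n, ∑ j : Fin n, P x (i, j) * partialDeriv j φ x i

/-- The Sobolev norm `‖φ‖_{L^r(Ω)} + ‖∇φ‖_{L^r(Ω)}` of a test function. -/
def sobolevNorm {n : ℕ} {Ω : Opens (Pt n)} {V : Type*} [NormedAddCommGroup V] [NormedSpace ℝ V]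
    (r : ℝ≥0∞) (φ : TestFunction Ω V ⊤) : ℝ≥0∞ :=
  eLpNorm φ r (volume.restrict (Ω : Set (Pt n))) +
    eLpNorm (fderiv ℝ φ) r (volume.restrict (Ω : Set (Pt n)))

/-- The norm of a (linear) functional `T` on test functions in `W^{-1,p}(Ω; V)`, the dual of
`W₀^{1,p'}(Ω; V)` with `1/p + 1/p' = 1`. As `W₀^{1,p'}` is the closure of the test functions in
`W^{1,p'}`, this is the supremum over the test functions in the unit ball; it is `∞` if `T` does
not belong to `W^{-1,p}(Ω; V)`. -/
def negSobolevNorm {n : ℕ} {Ω : Opens (Pt n)} {V : Type*} [NormedAddCommGroup V]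
    [NormedSpace ℝ V] (p : ℝ≥0∞) (T : TestFunction Ω V ⊤ → ℝ) : ℝ≥0∞ :=
  ⨆ (φ : TestFunction Ω V ⊤) (_ : sobolevNorm p.conjExponent φ ≤ 1), ENNReal.ofReal |T φ|

/-- Div-curl convergence of a sequence of states `z k = (F_k, P_k)` to `w = (F, P)`: weak
convergence in `X_{p,q}(Ω)`, `curl F_k → curl F` strongly in `W^{-1,p}` and `div P_k → div P`
strongly in `W^{-1,q}`. -/
def DivCurlTendsto {n : ℕ} {p q : ℝ≥0∞} [Fact (1 ≤ p)] [Fact (1 ≤ q)] {Ω : Opens (Pt n)}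
    (z : ℕ → PhaseSpace p q Ω) (w : PhaseSpace p q Ω) : Prop :=
  Tendsto (fun k => toWeakSpace ℝ (PhaseSpace p q Ω) (z k)) atTop
      (𝓝 (toWeakSpace ℝ (PhaseSpace p q Ω) w)) ∧
    Tendsto (fun k => negSobolevNorm p
      (fun φ : TestFunction Ω (Tens n) ⊤ => curl (z k).1 φ - curl w.1 φ)) atTop (𝓝 0) ∧
    Tendsto (fun k => negSobolevNorm q
      (fun φ : TestFunction Ω (Pt n) ⊤ => div (z k).2 φ - div w.2 φ)) atTop (𝓝 0)

/-- A set of states `D ⊆ X_{p,q}(Ω)` is div-curl-closed if it contains the limits of all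
div-curl-convergent sequences in `D`. -/
def IsDivCurlClosed {n : ℕ} {p q : ℝ≥0∞} [Fact (1 ≤ p)] [Fact (1 ≤ q)] {Ω : Opens (Pt n)}
    (D : Set (PhaseSpace p q Ω)) : Prop :=
  ∀ (z : ℕ → PhaseSpace p q Ω) (w : PhaseSpace p q Ω),
    (∀ k, z k ∈ D) → DivCurlTendsto z w → w ∈ D

/-- The global data set generated by a local one:
`{(F, P) ∈ X_{p,q}(Ω) : (F(x), P(x)) ∈ D_loc for a.e. x ∈ Ω}`. -/
def dataSet {n : ℕ} (p q : ℝ≥0∞) (Ω : Opens (Pt n)) (Dloc : Set (Mat n × Mat n)) :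
    Set (PhaseSpace p q Ω) :=
  {z | ∀ᵐ x ∂(volume.restrict (Ω : Set (Pt n))), (z.1 x, z.2 x) ∈ Dloc}

/-- `D_loc` is locally `(p,q)`-div-curl-closed: for all bounded nonempty open `ω ⊆ ℝⁿ` and all
matrices `F₀, P₀`, if a sequence in `X_{p,q}(ω)` with values a.e. in `D_loc` div-curl-converges
to the state `w` that is constant equal to `(F₀, P₀)`, then `(F₀, P₀) ∈ D_loc`. -/
def IsLocallyDivCurlClosed {n : ℕ} (p q : ℝ≥0∞) [Fact (1 ≤ p)] [Fact (1 ≤ q)]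
    (Dloc : Set (Mat n × Mat n)) : Prop :=
  ∀ ω : Opens (Pt n), (ω : Set (Pt n)).Nonempty → Bornology.IsBounded (ω : Set (Pt n)) →
    ∀ (F₀ P₀ : Mat n) (z : ℕ → PhaseSpace p q ω) (w : PhaseSpace p q ω),
      (∀ᵐ x ∂(volume.restrict (ω : Set (Pt n))), w.1 x = F₀ ∧ w.2 x = P₀) →
      (∀ k, ∀ᵐ x ∂(volume.restrict (ω : Set (Pt n))), ((z k).1 x, (z k).2 x) ∈ Dloc) →
      DivCurlTendsto z w → (F₀, P₀) ∈ Dloc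

end DivCurl

end

/-! Both implications rest on composition with the affine maps `y ↦ a + r y`. If such a map sends
one open set into another, pulling states back along it preserves membership in the data set. It
also preserves div-curl convergence (`DivCurlTendsto.rescale`): it is bounded on `L^p × L^q`, and
transporting a test function the other way changes its Sobolev norm by a factor depending only on
the map.

From global to local: `ω` contains a shrunken, translated copy of the bounded set `Ω`. The sequence
on `ω` pulls back to `Ω`, its limit is the same constant, and `Ω` has positive measure.

From local to global: blow up at almost every `x`. At a fixed radius the rescaled `z k`
div-curl-converge to the rescaled `w`; along suitable radii tending to zero the rescaled `w`
converge in norm on the unit ball to the constant `w(x)`. A diagonal sequence then yields `w(x) ∈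
Dloc`, once two obstacles are removed.

The blown-up states must stay bounded, although `|z k|^p` may concentrate near individual points. By
Tonelli and translation invariance their local averages are bounded in `L¹(dx)` uniformly in radius
and `k`. Fatou's lemma, in `k` and then in the radius, bounds them at almost every `x` along
infinitely many radii and, for each of these, infinitely many `k` (`ae_exists_frequently_le`,
`exists_radii`).

Weak convergence must be reached diagonally. Since `1 < p, q < ∞`, Riesz representation makes the
dual of the phase space on the ball separable; for a bounded sequence it suffices to control ever
more members of one dense sequence of functionals (`tendsto_of_dense_functionals`,
`divCurlTendsto_of_approx`). -/

noncomputable section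

set_option maxSynthPendingDepth 3

namespace DivCurl

/-! ### Riesz representation and separability of the dual of `L^p` -/

section Duality

variable {α : Type*} [MeasurableSpace α] {μ : Measure α}

/-- Continuous functionals on `L^p` are determined by their values on indicator functions. -/
theorem lp_functional_ext [IsFiniteMeasure μ] {p : ℝ≥0∞} [Fact (1 ≤ p)] (hp : p ≠ ∞)
    {ℓ₁ ℓ₂ : Lp ℝ p μ →L[ℝ] ℝ}
    (h : ∀ (s : Set α) (hs : MeasurableSet s),
      ℓ₁ (indicatorConstLp p hs (measure_ne_top μ s) 1) =
        ℓ₂ (indicatorConstLp p hs (measure_ne_top μ s) 1)) : ℓ₁ = ℓ₂ := by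
  ext f
  induction f using Lp.induction hp with
  | @indicatorConst c s hs hμs =>
    have : ((Lp.simpleFunc.indicatorConst p hs hμs.ne c : Lp.simpleFunc ℝ p μ) : Lp ℝ p μ) =
        c • indicatorConstLp p hs (measure_ne_top μ s) 1 := by
      rw [Lp.simpleFunc.coe_indicatorConst]
      refine Lp.ext ?_
      filter_upwards [indicatorConstLp_coeFn (p := p) (hs := hs) (hμs := hμs.ne) (c := c),
        indicatorConstLp_coeFn (p := p) (hs := hs) (hμs := measure_ne_top μ s) (c := (1 : ℝ)),
        Lp.coeFn_smul c (indicatorConstLp p hs (measure_ne_top μ s) (1 : ℝ))] with x h1 h2 h3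
      rw [h1, h3, Pi.smul_apply, h2]
      by_cases hx : x ∈ s <;> simp [hx]
    rw [this, map_smul, map_smul, h]
  | add hf hg _ h1 h2 => rw [map_add, map_add, h1, h2]
  | isClosed => exact isClosed_eq ℓ₁.continuous ℓ₂.continuous

/-- The set function of a functional on `L^p`, as a signed measure. -/
def functionalMeasure [IsFiniteMeasure μ] {p : ℝ≥0∞} [Fact (1 ≤ p)] (hp : p ≠ ∞)
    (ℓ : Lp ℝ p μ →L[ℝ] ℝ) : SignedMeasure α where
  measureOf' s := by
    classical
    exact if hs : MeasurableSet s then ℓ (indicatorConstLp p hs (measure_ne_top μ s) 1) else 0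
  empty' := by simp
  not_measurable' s hs := by simp [hs]
  m_iUnion' f hf hd := by
    have hU := MeasurableSet.iUnion hf
    have hfin : ∀ s : Finset ℕ, MeasurableSet (⋃ i ∈ s, f i) :=
      fun s => s.measurableSet_biUnion fun i _ => hf i
    have key : ∀ s : Finset ℕ, ∑ i ∈ s, ℓ (indicatorConstLp p (hf i) (measure_ne_top μ _) 1) =
        ℓ (indicatorConstLp p (hfin s) (measure_ne_top μ _) 1) := by
      intro s
      induction s using Finset.induction_on with
      | empty => simp
      | insert a s ha ih =>
        rw [Finset.sum_insert ha, ih, ← map_add]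
        have hdis : Disjoint (f a) (⋃ i ∈ s, f i) := by
          rw [Set.disjoint_iUnion₂_right]
          intro i hi
          exact hd (by rintro rfl; exact ha hi)
        rw [← indicatorConstLp_disjoint_union (hf a) (hfin s) _ _ hdis]
        congr 2
        simp
    -- Countable additivity is continuity of `ℓ`: the indicators of finite unions converge in `L^p`,
    -- because `p ≠ ∞` and the measures of the symmetric differences tend to zero.
    have hsum : HasSum (fun i => ℓ (indicatorConstLp p (hf i) (measure_ne_top μ _) 1))
        (ℓ (indicatorConstLp p hU (measure_ne_top μ _) 1)) := by
      unfold HasSum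
      simp_rw [key]
      refine (ℓ.continuous.tendsto _).comp ?_
      refine tendsto_indicatorConstLp_set hp ?_
      have h1 : HasSum (fun i => μ (f i)) (μ (⋃ i, f i)) := by
        rw [measure_iUnion hd hf]; exact ENNReal.summable.hasSum
      have h2 : ∀ s : Finset ℕ, μ (symmDiff (⋃ i ∈ s, f i) (⋃ i, f i)) =
          μ (⋃ i, f i) - ∑ i ∈ s, μ (f i) := by
        intro s
        have hsub : (⋃ i ∈ s, f i) ⊆ ⋃ i, f i := Set.iUnion₂_subset_iUnion _ _
        rw [symmDiff_of_le hsub, measure_sdiff hsub (hfin s).nullMeasurableSet (measure_ne_top _ _),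
          measure_biUnion_finset (fun i _ j _ hij => hd hij) (fun i _ => hf i)]
      simp_rw [h2]
      have := ENNReal.Tendsto.sub (tendsto_const_nhds (x := μ (⋃ i, f i)) (f := atTop)) h1
        (Or.inl (measure_ne_top _ _))
      simpa using this
    simpa [hf, hU] using hsum

theorem functionalMeasure_apply [IsFiniteMeasure μ] {p : ℝ≥0∞} [Fact (1 ≤ p)] (hp : p ≠ ∞)
    (ℓ : Lp ℝ p μ →L[ℝ] ℝ) {s : Set α} (hs : MeasurableSet s) :
    functionalMeasure hp ℓ s = ℓ (indicatorConstLp p hs (measure_ne_top μ s) 1) := by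
  classical
  exact dif_pos hs

/-- A functional on `L^p` has an integrable density with respect to indicator functions. -/
theorem exists_density [IsFiniteMeasure μ] {p : ℝ≥0∞} [Fact (1 ≤ p)] (hp : p ≠ ∞)
    (ℓ : Lp ℝ p μ →L[ℝ] ℝ) :
    ∃ g : α → ℝ, Measurable g ∧ Integrable g μ ∧ ∀ (s : Set α) (hs : MeasurableSet s),
      ℓ (indicatorConstLp p hs (measure_ne_top μ s) 1) = ∫ x in s, g x ∂μ := by
  set ν := functionalMeasure hp ℓ
  have hac : ν ≪ᵥ μ.toENNRealVectorMeasure := by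
    refine VectorMeasure.AbsolutelyContinuous.mk fun s hs h0 => ?_
    rw [Measure.toENNRealVectorMeasure_apply_measurable hs] at h0
    rw [functionalMeasure_apply hp ℓ hs]
    have : indicatorConstLp p hs (measure_ne_top μ s) (1 : ℝ) = 0 := by
      rw [← norm_le_zero_iff]
      refine norm_indicatorConstLp_le.trans ?_
      have hp0 : p ≠ 0 := (zero_lt_one.trans_le (Fact.out : 1 ≤ p)).ne'
      have : 1 / p.toReal ≠ 0 := by
        rw [one_div]; exact inv_ne_zero (ENNReal.toReal_pos hp0 hp).ne'
      rw [measureReal_def, h0, ENNReal.toReal_zero, Real.zero_rpow this, mul_zero]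
    rw [this, map_zero]
  refine ⟨ν.rnDeriv μ, SignedMeasure.measurable_rnDeriv _ _,
    SignedMeasure.integrable_rnDeriv _ _, fun s hs => ?_⟩
  rw [← functionalMeasure_apply hp ℓ hs, ← withDensityᵥ_apply
    (SignedMeasure.integrable_rnDeriv _ _) hs, SignedMeasure.withDensityᵥ_rnDeriv_eq ν μ hac]

/-- The norm of an element of `L^q` is at most the norm of the functional it induces on `L^p`. -/
theorem norm_le_norm_lpPairing {p q : ℝ≥0∞} [Fact (1 ≤ p)] [Fact (1 ≤ q)]
    [ENNReal.HolderConjugate q p] (hp : p ≠ ∞) (hq : q ≠ ∞) (g : Lp ℝ q μ) :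
    ‖g‖ ≤ ‖(ContinuousLinearMap.mul ℝ ℝ).lpPairing μ q p g‖ := by
  have hc : q.toReal.HolderConjugate p.toReal :=
    ENNReal.HolderConjugate.toReal_of_ne_top hq hp
  set Λ := (ContinuousLinearMap.mul ℝ ℝ).lpPairing μ q p g
  rcases eq_or_ne ‖g‖ 0 with h0 | h0
  · rw [h0]; exact norm_nonneg _
  have hgpos : 0 < ‖g‖ := lt_of_le_of_ne (norm_nonneg _) h0.symm
  set r := q.toReal - 1
  have hr : 0 < r := by have := hc.lt; simp only [r]; linarith
  have hexp : p * ENNReal.ofReal r = q := by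
    rw [← ENNReal.ofReal_toReal hp, ← ENNReal.ofReal_mul ENNReal.toReal_nonneg, mul_comm,
      hc.sub_one_mul_conj, ENNReal.ofReal_toReal hq]
  -- The extremal function in Hölder's inequality: `g f = |g|^q`, while `|f|^p = |g|^q` because `p
  -- (q - 1) = q`.
  let f : α → ℝ := fun x => SignType.sign (g x) * ‖g x‖ ^ r
  have hgm : AEStronglyMeasurable g μ := Lp.aestronglyMeasurable g
  have hfm : AEStronglyMeasurable f μ := by
    have h1 : AEMeasurable (fun x => ((SignType.sign (g x) : SignType) : ℝ)) μ := by
      have : Measurable fun t : ℝ => ((SignType.sign t : SignType) : ℝ) := by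
        have : (fun t : ℝ => ((SignType.sign t : SignType) : ℝ)) =
            fun t => if 0 < t then 1 else if t < 0 then -1 else 0 := by
          ext t
          rcases lt_trichotomy t 0 with h | h | h
          · simp [h, not_lt.2 h.le]
          · simp [h]
          · simp [h]
        rw [this]
        exact Measurable.ite measurableSet_Ioi measurable_const
          (Measurable.ite measurableSet_Iio measurable_const measurable_const)
      exact this.comp_aemeasurable hgm.aemeasurable
    exact (h1.mul (hgm.aemeasurable.norm.pow_const r)).aestronglyMeasurable
  have hfn : ∀ x, ‖f x‖ = ‖‖g x‖ ^ r‖ := by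
    intro x
    simp only [f, norm_mul]
    rcases lt_trichotomy (g x) 0 with h | h | h
    · simp [h]
    · simp [h, Real.zero_rpow hr.ne']
    · simp [h]
  have hfe : eLpNorm f p μ = eLpNorm g q μ ^ r := by
    rw [eLpNorm_congr_norm_ae (Eventually.of_forall hfn), eLpNorm_norm_rpow _ hr, hexp]
  have hfL : MemLp f p μ :=
    ⟨hfm, by rw [hfe]; exact ENNReal.rpow_lt_top_of_nonneg hr.le (Lp.eLpNorm_ne_top g)⟩
  have hfnorm : ‖hfL.toLp f‖ = ‖g‖ ^ r := by
    rw [Lp.norm_toLp, hfe, ← ENNReal.toReal_rpow, Lp.norm_def]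
  have hΛ : Λ (hfL.toLp f) = ‖g‖ ^ q.toReal := by
    have hq0 : q ≠ 0 := (zero_lt_one.trans_le (Fact.out : 1 ≤ q)).ne'
    rw [ContinuousLinearMap.lpPairing_eq_integral, Lp.norm_def,
      (Lp.memLp g).eLpNorm_eq_integral_rpow_norm hq0 hq,
      ENNReal.toReal_ofReal (by positivity), ← Real.rpow_mul (by positivity),
      inv_mul_cancel₀ hc.ne_zero, Real.rpow_one]
    refine integral_congr_ae ?_
    filter_upwards [hfL.coeFn_toLp] with x hx
    rw [hx]
    simp only [ContinuousLinearMap.mul_apply', f]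
    have h1 : g x * SignType.sign (g x) = ‖g x‖ := by
      rw [Real.norm_eq_abs, self_mul_sign]
    rw [← mul_assoc, h1]
    rcases eq_or_ne ‖g x‖ 0 with h | h
    · rw [h, Real.zero_rpow hc.ne_zero, zero_mul]
    · have : q.toReal = 1 + r := by simp [r]
      rw [this, Real.rpow_add (lt_of_le_of_ne (norm_nonneg _) h.symm), Real.rpow_one]
  have hle := Λ.le_opNorm (hfL.toLp f)
  rw [hΛ, hfnorm] at hle
  have hsplit : ‖g‖ ^ q.toReal = ‖g‖ * ‖g‖ ^ r := by
    have : q.toReal = 1 + r := by simp [r]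
    rw [this, Real.rpow_add hgpos, Real.rpow_one]
  rw [hsplit, Real.norm_of_nonneg (by positivity)] at hle
  exact le_of_mul_le_mul_right hle (by positivity)

/-- Restriction of `L^p` functions to a measurable set, as an operator on `L^p`. -/
def indicatorL (μ : Measure α) (p : ℝ≥0∞) [Fact (1 ≤ p)] {s : Set α} (hs : MeasurableSet s) :
    Lp ℝ p μ →L[ℝ] Lp ℝ p μ :=
  LinearMap.mkContinuous
    { toFun := fun f => ((Lp.memLp f).indicator hs).toLp _
      map_add' := fun f g => by
        rw [← MemLp.toLp_add]
        refine MemLp.toLp_congr _ _ ?_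
        filter_upwards [Lp.coeFn_add f g] with x hx
        rw [Pi.add_apply]
        by_cases h : x ∈ s
        · rw [Set.indicator_of_mem h, Set.indicator_of_mem h, Set.indicator_of_mem h, hx,
            Pi.add_apply]
        · simp [h]
      map_smul' := fun c f => by
        rw [RingHom.id_apply, ← MemLp.toLp_const_smul]
        refine MemLp.toLp_congr _ _ ?_
        filter_upwards [Lp.coeFn_smul c f] with x hx
        rw [Pi.smul_apply]
        by_cases h : x ∈ s
        · rw [Set.indicator_of_mem h, Set.indicator_of_mem h, hx, Pi.smul_apply]
        · simp [h] }
    1 fun f => by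
      rw [one_mul]
      refine Lp.norm_le_norm_of_ae_le ?_
      filter_upwards [((Lp.memLp f).indicator hs).coeFn_toLp] with x hx
      rw [LinearMap.coe_mk, AddHom.coe_mk, hx]
      exact norm_indicator_le_norm_self _ _

theorem indicatorL_coeFn {p : ℝ≥0∞} [Fact (1 ≤ p)] {s : Set α} (hs : MeasurableSet s)
    (f : Lp ℝ p μ) : indicatorL μ p hs f =ᵐ[μ] s.indicator f :=
  ((Lp.memLp f).indicator hs).coeFn_toLp

theorem norm_indicatorL_le {p : ℝ≥0∞} [Fact (1 ≤ p)] {s : Set α} (hs : MeasurableSet s) :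
    ‖indicatorL μ p hs‖ ≤ 1 :=
  LinearMap.mkContinuous_norm_le _ zero_le_one _

theorem lpPairing_indicatorConstLp [IsFiniteMeasure μ] {p q : ℝ≥0∞} [Fact (1 ≤ p)] [Fact (1 ≤ q)]
    [ENNReal.HolderConjugate q p] (g : Lp ℝ q μ) {s : Set α} (hs : MeasurableSet s) :
    (ContinuousLinearMap.mul ℝ ℝ).lpPairing μ q p g
      (indicatorConstLp p hs (measure_ne_top μ s) 1) = ∫ x in s, g x ∂μ := by
  rw [ContinuousLinearMap.lpPairing_eq_integral, ← integral_indicator hs]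
  refine integral_congr_ae ?_
  filter_upwards [indicatorConstLp_coeFn (p := p) (hs := hs) (hμs := measure_ne_top μ s)
    (c := (1 : ℝ))] with x hx
  rw [hx]
  by_cases h : x ∈ s <;> simp [h]

/-- **Riesz representation** for `L^p` over a finite measure. -/
theorem lpPairing_surjective [IsFiniteMeasure μ] {p q : ℝ≥0∞} [Fact (1 ≤ p)] [Fact (1 ≤ q)]
    [ENNReal.HolderConjugate q p] (hp : p ≠ ∞) (hq : q ≠ ∞) :
    Function.Surjective ((ContinuousLinearMap.mul ℝ ℝ).lpPairing μ q p) := by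
  intro ℓ
  obtain ⟨g, hgm, hgi, hg⟩ := exists_density hp ℓ
  -- The density is so far only integrable. Its truncations are bounded, hence in `L^q`, and
  -- represent `ℓ` composed with a contraction, which bounds their norms by `‖ℓ‖`.
  let E : ℕ → Set α := fun N => {x | ‖g x‖ ≤ N}
  have hE : ∀ N, MeasurableSet (E N) := fun N => measurableSet_le hgm.norm measurable_const
  have hgN : ∀ N, MemLp ((E N).indicator g) q μ := fun N => by
    refine MemLp.of_bound (hgm.indicator (hE N)).aestronglyMeasurable N ?_
    refine Eventually.of_forall fun x => ?_
    by_cases h : x ∈ E N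
    · rw [Set.indicator_of_mem h]; exact h
    · rw [Set.indicator_of_notMem h]; simp
  have hrep : ∀ N, (ContinuousLinearMap.mul ℝ ℝ).lpPairing μ q p ((hgN N).toLp _) =
      ℓ.comp (indicatorL μ p (hE N)) := fun N => by
    refine lp_functional_ext hp fun s hs => ?_
    rw [lpPairing_indicatorConstLp, ContinuousLinearMap.comp_apply]
    have : indicatorL μ p (hE N) (indicatorConstLp p hs (measure_ne_top μ s) 1) =
        indicatorConstLp p (hs.inter (hE N)) (measure_ne_top μ _) 1 := by
      refine Lp.ext ?_
      filter_upwards [indicatorL_coeFn (hE N) (indicatorConstLp p hs (measure_ne_top μ s) (1 : ℝ)),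
        indicatorConstLp_coeFn (p := p) (hs := hs) (hμs := measure_ne_top μ s) (c := (1 : ℝ)),
        indicatorConstLp_coeFn (p := p) (hs := hs.inter (hE N)) (hμs := measure_ne_top μ _)
          (c := (1 : ℝ))] with x h1 h2 h3
      rw [h1, h3, Set.inter_comm, ← Set.indicator_indicator]
      by_cases hx : x ∈ E N <;> simp [hx, h2]
    rw [this, hg, ← setIntegral_indicator (hE N)]
    refine integral_congr_ae ?_
    exact ae_restrict_of_ae (hgN N).coeFn_toLp
  have hbound : ∀ N, eLpNorm ((E N).indicator g) q μ ≤ ENNReal.ofReal ‖ℓ‖ := fun N => by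
    have h1 := norm_le_norm_lpPairing hp hq ((hgN N).toLp _)
    rw [hrep N] at h1
    have h2 : ‖ℓ.comp (indicatorL μ p (hE N))‖ ≤ ‖ℓ‖ :=
      (ℓ.opNorm_comp_le _).trans (mul_le_of_le_one_right (norm_nonneg _) (norm_indicatorL_le _))
    rw [Lp.norm_toLp] at h1
    exact (ENNReal.le_ofReal_iff_toReal_le (hgN N).2.ne (norm_nonneg _)).2 (h1.trans h2)
  have hgL : MemLp g q μ := by
    refine ⟨hgm.aestronglyMeasurable, ?_⟩
    have hlim : ∀ x, Tendsto (fun N => (E N).indicator g x) atTop (𝓝 (g x)) := fun x => by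
      refine tendsto_const_nhds.congr' ?_
      obtain ⟨N, hN⟩ := exists_nat_ge ‖g x‖
      filter_upwards [eventually_ge_atTop N] with M hM
      exact (Set.indicator_of_mem (show x ∈ E M from hN.trans (by exact_mod_cast hM)) _).symm
    -- Fatou's lemma carries the uniform bound from the truncations to `g`.
    refine (Lp.eLpNorm_lim_le_liminf_eLpNorm
      (fun N => (hgN N).1) g (Eventually.of_forall hlim)).trans_lt ?_
    refine lt_of_le_of_lt ?_ (ENNReal.ofReal_lt_top (r := ‖ℓ‖))
    exact liminf_le_of_frequently_le' (Frequently.of_forall hbound)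
  refine ⟨hgL.toLp g, lp_functional_ext hp fun s hs => ?_⟩
  rw [lpPairing_indicatorConstLp, hg]
  exact integral_congr_ae (ae_restrict_of_ae hgL.coeFn_toLp)

/-- The dual is a continuous image of `L^q` for the conjugate exponent, which is separable because
`1 < p` forces `q ≠ ∞`. -/
theorem separableSpace_dual_lp_real [IsFiniteMeasure μ] [IsSeparable μ] {p : ℝ≥0∞} [Fact (1 ≤ p)]
    (hp1 : 1 < p) (hp : p ≠ ∞) : SeparableSpace (Lp ℝ p μ →L[ℝ] ℝ) := by
  have : ENNReal.HolderConjugate p p.conjExponent := .conjExponent hp1.le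
  have : ENNReal.HolderConjugate p.conjExponent p := this.symm
  have : Fact (1 ≤ p.conjExponent) := ⟨ENNReal.HolderConjugate.one_le _ p⟩
  have hq : p.conjExponent ≠ ∞ := by
    rw [ENNReal.conjExponent]
    simp [tsub_eq_zero_iff_le, hp1]
  have : Fact (p.conjExponent ≠ ∞) := ⟨hq⟩
  have h := lpPairing_surjective (μ := μ) hp hq
  exact h.denseRange.separableSpace (ContinuousLinearMap.continuous _)

theorem separableSpace_dual_lp [IsFiniteMeasure μ] [IsSeparable μ] {p : ℝ≥0∞} [Fact (1 ≤ p)]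
    (hp1 : 1 < p) (hp : p ≠ ∞) (ι : Type*) [Fintype ι] :
    SeparableSpace (Lp (EuclideanSpace ℝ ι) p μ →L[ℝ] ℝ) := by
  classical
  have := separableSpace_dual_lp_real (μ := μ) hp1 hp
  let inj : ι → Lp ℝ p μ →L[ℝ] Lp (EuclideanSpace ℝ ι) p μ := fun i =>
    ((ContinuousLinearMap.id ℝ ℝ).smulRight (EuclideanSpace.single i (1 : ℝ))).compLpL p μ
  let proj : ι → Lp (EuclideanSpace ℝ ι) p μ →L[ℝ] Lp ℝ p μ := fun i =>
    (EuclideanSpace.proj i : EuclideanSpace ℝ ι →L[ℝ] ℝ).compLpL p μ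
  have hdec : ∀ f : Lp (EuclideanSpace ℝ ι) p μ, ∑ i, inj i (proj i f) = f := by
    intro f
    refine Lp.ext ?_
    have h1 : ∀ᵐ x ∂μ, ∀ i, (inj i (proj i f)) x =
        EuclideanSpace.single i (f x i) := by
      rw [ae_all_iff]
      intro i
      filter_upwards [((ContinuousLinearMap.id ℝ ℝ).smulRight
        (EuclideanSpace.single i (1 : ℝ))).coeFn_compLp (proj i f),
        (EuclideanSpace.proj i : EuclideanSpace ℝ ι →L[ℝ] ℝ).coeFn_compLp f] with x h1 h2
      refine h1.trans ?_
      have h2' : (proj i f) x = f x i := h2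
      ext j
      simp [h2']
    filter_upwards [h1, Lp.coeFn_finsetSum Finset.univ fun i => inj i (proj i f)] with x hx hs
    rw [hs, Finset.sum_apply, Finset.sum_congr rfl fun i _ => hx i]
    ext j
    simp [Pi.single_apply]
  let Φ : (ι → (Lp ℝ p μ →L[ℝ] ℝ)) → (Lp (EuclideanSpace ℝ ι) p μ →L[ℝ] ℝ) :=
    fun ℓ => ∑ i, (ℓ i).comp (proj i)
  have hΦ : Continuous Φ := by
    refine continuous_finsetSum _ fun i _ => ?_
    exact (continuous_apply i).clm_comp continuous_const
  have hs : Function.Surjective Φ := fun ℓ => by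
    refine ⟨fun i => ℓ.comp (inj i), ?_⟩
    ext f
    simp only [Φ, sum_apply, ContinuousLinearMap.comp_apply]
    rw [← map_sum, hdec]
  exact hs.denseRange.separableSpace hΦ

end Duality

/-! ### First order operators with constant coefficients in negative Sobolev norms -/

section FirstOrder

variable {n : ℕ} {V : Type*} [NormedAddCommGroup V] [NormedSpace ℝ V]

/-- The distribution `φ ↦ -∫ b (F, Dφ)` of a first order differential operator with constant
coefficients, encoded by the bilinear form `b`. -/
def firstOrder {Ω : Opens (Pt n)} (b : Mat n →L[ℝ] (Pt n →L[ℝ] V) →L[ℝ] ℝ) (F : Pt n → Mat n)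
    (φ : TestFunction Ω V ⊤) : ℝ :=
  - ∫ x in (Ω : Set (Pt n)), b (F x) (fderiv ℝ φ x)

/-- The elementary form `(M, L) ↦ M e * (L v) i`. -/
def entryForm (e : Fin n × Fin n) {ι : Type*} [Fintype ι] (i : ι) (v : Pt n) :
    Mat n →L[ℝ] (Pt n →L[ℝ] EuclideanSpace ℝ ι) →L[ℝ] ℝ :=
  (ContinuousLinearMap.mul ℝ ℝ).bilinearComp (EuclideanSpace.proj e)
    ((EuclideanSpace.proj i : EuclideanSpace ℝ ι →L[ℝ] ℝ).comp
      (ContinuousLinearMap.apply ℝ (EuclideanSpace ℝ ι) v))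

@[simp] theorem entryForm_apply (e : Fin n × Fin n) {ι : Type*} [Fintype ι] (i : ι) (v : Pt n)
    (M : Mat n) (L : Pt n →L[ℝ] EuclideanSpace ℝ ι) : entryForm e i v M L = M e * L v i := rfl

/-- The bilinear form of the row-wise curl. -/
def curlForm (n : ℕ) : Mat n →L[ℝ] (Pt n →L[ℝ] Tens n) →L[ℝ] ℝ :=
  ∑ i : Fin n, ∑ j : Fin n, ∑ k : Fin n,
    (entryForm (i, j) (i, j, k) (EuclideanSpace.single k 1) -
      entryForm (i, k) (i, j, k) (EuclideanSpace.single j 1))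

/-- The bilinear form of the row-wise divergence. -/
def divForm (n : ℕ) : Mat n →L[ℝ] (Pt n →L[ℝ] Pt n) →L[ℝ] ℝ :=
  ∑ i : Fin n, ∑ j : Fin n, entryForm (i, j) i (EuclideanSpace.single j 1)

/-- Curl and divergence enter the argument only through their bilinear forms, so each estimate is
proved once for a general form. -/
theorem curl_eq_firstOrder {Ω : Opens (Pt n)} (F : Pt n → Mat n) (φ : TestFunction Ω (Tens n) ⊤) :
    curl F φ = firstOrder (curlForm n) F φ := by
  simp [curl, firstOrder, curlForm, partialDeriv, sum_apply]

theorem div_eq_firstOrder {Ω : Opens (Pt n)} (F : Pt n → Mat n) (φ : TestFunction Ω (Pt n) ⊤) :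
    div F φ = firstOrder (divForm n) F φ := by
  simp [div, firstOrder, divForm, partialDeriv, sum_apply]

theorem firstOrder_congr {Ω : Opens (Pt n)} (b : Mat n →L[ℝ] (Pt n →L[ℝ] V) →L[ℝ] ℝ)
    {F G : Pt n → Mat n} (h : F =ᵐ[volume.restrict (Ω : Set (Pt n))] G)
    (φ : TestFunction Ω V ⊤) : firstOrder b F φ = firstOrder b G φ := by
  unfold firstOrder
  congr 1
  refine integral_congr_ae ?_
  filter_upwards [h] with x hx
  rw [hx]

theorem negSobolevNorm_add_le {Ω : Opens (Pt n)} (p : ℝ≥0∞) (S T : TestFunction Ω V ⊤ → ℝ) :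
    negSobolevNorm p (fun φ => S φ + T φ) ≤ negSobolevNorm p S + negSobolevNorm p T := by
  refine iSup₂_le fun φ hφ => ?_
  calc ENNReal.ofReal |S φ + T φ| ≤ ENNReal.ofReal (|S φ| + |T φ|) :=
        ENNReal.ofReal_le_ofReal (abs_add_le _ _)
    _ = ENNReal.ofReal |S φ| + ENNReal.ofReal |T φ| :=
        ENNReal.ofReal_add (abs_nonneg _) (abs_nonneg _)
    _ ≤ _ := add_le_add
        (le_iSup₂ (f := fun (φ : TestFunction Ω V ⊤) (_ : sobolevNorm p.conjExponent φ ≤ 1) =>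
          ENNReal.ofReal |S φ|) φ hφ)
        (le_iSup₂ (f := fun (φ : TestFunction Ω V ⊤) (_ : sobolevNorm p.conjExponent φ ≤ 1) =>
          ENNReal.ofReal |T φ|) φ hφ)

/-- The `W^{-1,p}` norm of a first order operator is controlled by the `L^p` norm. -/
theorem negSobolevNorm_firstOrder_sub_le {Ω : Opens (Pt n)} {p : ℝ≥0∞} (hp : 1 ≤ p)
    (b : Mat n →L[ℝ] (Pt n →L[ℝ] V) →L[ℝ] ℝ) {F G : Pt n → Mat n}
    (hF : MemLp F p (volume.restrict (Ω : Set (Pt n))))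
    (hG : MemLp G p (volume.restrict (Ω : Set (Pt n)))) :
    negSobolevNorm p (fun φ : TestFunction Ω V ⊤ => firstOrder b F φ - firstOrder b G φ) ≤
      ‖b‖ₑ * eLpNorm (F - G) p (volume.restrict (Ω : Set (Pt n))) := by
  have hpq : ENNReal.HolderConjugate p p.conjExponent := .conjExponent hp
  refine iSup₂_le fun φ hφ => ?_
  have hD : Continuous (fderiv ℝ φ) := φ.contDiff.continuous_fderiv (by simp)
  have hDm : MemLp (fderiv ℝ φ) p.conjExponent (volume.restrict (Ω : Set (Pt n))) :=
    (hD.memLp_of_hasCompactSupport (φ.hasCompactSupport.fderiv ℝ)).restrict _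
  have hint : ∀ {H : Pt n → Mat n}, MemLp H p (volume.restrict (Ω : Set (Pt n))) →
      Integrable (fun x => b (H x) (fderiv ℝ φ x)) (volume.restrict (Ω : Set (Pt n))) :=
    fun hH => memLp_one_iff_integrable.1 (b.memLp_of_bilin 1 hH hDm)
  have h1 : firstOrder b F φ - firstOrder b G φ =
      - ∫ x in (Ω : Set (Pt n)), b ((F - G) x) (fderiv ℝ φ x) := by
    unfold firstOrder
    rw [neg_sub_neg, ← integral_sub (hint hG) (hint hF), ← integral_neg]
    refine integral_congr_ae (Eventually.of_forall fun x => ?_)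
    simp
  rw [← Real.enorm_eq_ofReal_abs]
  beta_reduce
  rw [h1, enorm_neg]
  refine (enorm_integral_le_lintegral_enorm _).trans ?_
  rw [← eLpNorm_one_eq_lintegral_enorm]
  have h2 := eLpNorm_le_eLpNorm_mul_eLpNorm_of_nnnorm (p := p) (q := p.conjExponent) (r := 1)
    (hF.sub hG).1 hDm.1 (fun M L => b M L) ‖b‖₊
    (Eventually.of_forall fun x => b.le_opNorm₂ _ _)
  refine h2.trans ?_
  have h3 : eLpNorm (fderiv ℝ φ) p.conjExponent (volume.restrict (Ω : Set (Pt n))) ≤ 1 :=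
    le_add_self.trans hφ
  calc _ ≤ ‖b‖ₑ * eLpNorm (F - G) p (volume.restrict (Ω : Set (Pt n))) * 1 := by gcongr; rfl
    _ = _ := mul_one _

end FirstOrder

/-! ### Composition operators between `L^p` spaces -/

section Composition

variable {α β : Type*} [MeasurableSpace α] [MeasurableSpace β] {μ : Measure α} {ν : Measure β}
  {E : Type*} [NormedAddCommGroup E]

/-- Requiring only an inequality between the measures covers dilation and restriction to a subdomain
at once. -/
theorem eLpNorm_comp_le {A : α → β} (hA : Measurable A) {c : ℝ≥0∞} (h : μ.map A ≤ c • ν)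
    {f : β → E} (hf : AEStronglyMeasurable f ν) (p : ℝ≥0∞) :
    eLpNorm (f ∘ A) p μ ≤ c ^ (1 / p).toReal * eLpNorm f p ν := by
  have hac : μ.map A ≪ ν := h.absolutelyContinuous.trans Measure.smul_absolutelyContinuous
  rw [← eLpNorm_map_measure (hf.mono_ac hac) hA.aemeasurable]
  exact (eLpNorm_mono_measure f h).trans (eLpNorm_smul_measure_le c f p ν)

theorem memLp_comp {A : α → β} (hA : Measurable A) {c : ℝ≥0∞} (hc : c ≠ ∞)
    (h : μ.map A ≤ c • ν) {f : β → E} {p : ℝ≥0∞} (hf : MemLp f p ν) : MemLp (f ∘ A) p μ := by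
  have hac : μ.map A ≪ ν := h.absolutelyContinuous.trans Measure.smul_absolutelyContinuous
  refine ⟨(hf.1.mono_ac hac).comp_measurable hA, ?_⟩
  exact (eLpNorm_comp_le hA h hf.1 p).trans_lt
    (ENNReal.mul_lt_top (ENNReal.rpow_lt_top_of_nonneg (by positivity) hc) hf.2)

/-- Composition with a map of bounded compression, as an operator between `L^p` spaces. -/
def compL (E : Type*) [NormedAddCommGroup E] [NormedSpace ℝ E] (p : ℝ≥0∞) [Fact (1 ≤ p)]
    {A : α → β} (hA : Measurable A) {c : ℝ≥0∞} (hc : c ≠ ∞) (h : μ.map A ≤ c • ν) :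
    Lp E p ν →L[ℝ] Lp E p μ :=
  LinearMap.mkContinuous
    { toFun := fun f => (memLp_comp hA hc h (Lp.memLp f)).toLp _
      map_add' := fun f g => by
        rw [← MemLp.toLp_add]
        refine MemLp.toLp_congr _ _ ?_
        exact ae_of_ae_map hA.aemeasurable ((h.absolutelyContinuous.trans
          Measure.smul_absolutelyContinuous).ae_eq (Lp.coeFn_add f g))
      map_smul' := fun a f => by
        rw [RingHom.id_apply, ← MemLp.toLp_const_smul]
        refine MemLp.toLp_congr _ _ ?_
        exact ae_of_ae_map hA.aemeasurable ((h.absolutelyContinuous.trans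
          Measure.smul_absolutelyContinuous).ae_eq (Lp.coeFn_smul a f)) }
    (c ^ (1 / p).toReal).toReal fun f => by
      rw [LinearMap.coe_mk, AddHom.coe_mk, Lp.norm_toLp, Lp.norm_def, ← ENNReal.toReal_mul]
      refine ENNReal.toReal_mono ?_ (eLpNorm_comp_le hA h (Lp.memLp f).1 p)
      exact (ENNReal.mul_lt_top (ENNReal.rpow_lt_top_of_nonneg (by positivity) hc)
        (Lp.memLp f).2).ne

theorem compL_coeFn [NormedSpace ℝ E] {p : ℝ≥0∞} [Fact (1 ≤ p)] {A : α → β}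
    (hA : Measurable A) {c : ℝ≥0∞} (hc : c ≠ ∞) (h : μ.map A ≤ c • ν) (f : Lp E p ν) : compL E p hA hc h f =ᵐ[μ] f ∘ A :=
  (memLp_comp hA hc h (Lp.memLp f)).coeFn_toLp

end Composition

/-! ### Weak convergence of sequences -/

section Weak

variable {X Y : Type*} [NormedAddCommGroup X] [NormedSpace ℝ X] [NormedAddCommGroup Y]
  [NormedSpace ℝ Y]

theorem tendsto_toWeakSpace_iff {ι : Type*} {l : Filter ι} {x : ι → X} {y : X} :
    Tendsto (fun k => toWeakSpace ℝ X (x k)) l (𝓝 (toWeakSpace ℝ X y)) ↔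
      ∀ ℓ : X →L[ℝ] ℝ, Tendsto (fun k => ℓ (x k)) l (𝓝 (ℓ y)) := by
  have h : Topology.IsInducing fun (x : WeakSpace ℝ X) (ℓ : X →L[ℝ] ℝ) =>
      (topDualPairing ℝ X).flip x ℓ := ⟨rfl⟩
  rw [h.tendsto_nhds_iff, tendsto_pi_nhds]
  rfl

theorem tendsto_toWeakSpace_map {ι : Type*} {l : Filter ι} {x : ι → X} {y : X}
    (h : Tendsto (fun k => toWeakSpace ℝ X (x k)) l (𝓝 (toWeakSpace ℝ X y))) (T : X →L[ℝ] Y) :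
    Tendsto (fun k => toWeakSpace ℝ Y (T (x k))) l (𝓝 (toWeakSpace ℝ Y (T y))) :=
  tendsto_toWeakSpace_iff.2 fun ℓ => tendsto_toWeakSpace_iff.1 h (ℓ.comp T)

/-- Weakly convergent sequences are bounded. -/
theorem exists_norm_le_of_tendsto_toWeakSpace {x : ℕ → X} {y : X}
    (h : Tendsto (fun k => toWeakSpace ℝ X (x k)) atTop (𝓝 (toWeakSpace ℝ X y))) :
    ∃ C : ℝ, ∀ k, ‖x k‖ ≤ C := by
  rw [tendsto_toWeakSpace_iff] at h
  -- Uniform boundedness is applied on the dual, which is complete whether or not `X` is; the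
  -- embedding into the bidual is isometric.
  obtain ⟨C, hC⟩ := banach_steinhaus (g := fun k => NormedSpace.inclusionInDoubleDual ℝ X (x k))
    fun ℓ => by
      obtain ⟨C, hC⟩ := (h ℓ).norm.bddAbove_range
      exact ⟨C, fun k => hC ⟨k, rfl⟩⟩
  refine ⟨C, fun k => ?_⟩
  rw [← (NormedSpace.inclusionInDoubleDualLi ℝ (E := X)).norm_map (x k)]
  exact hC k

/-- Bounded sequences converge weakly if they do so against a dense set of functionals. -/
theorem tendsto_of_dense_functionals {x : ℕ → X} {y : X} {C : ℝ} (hx : ∀ k, ‖x k‖ ≤ C)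
    {s : Set (X →L[ℝ] ℝ)} (hs : Dense s)
    (h : ∀ ℓ ∈ s, Tendsto (fun k => ℓ (x k)) atTop (𝓝 (ℓ y))) (ℓ : X →L[ℝ] ℝ) :
    Tendsto (fun k => ℓ (x k)) atTop (𝓝 (ℓ y)) := by
  rw [Metric.tendsto_atTop]
  intro ε hε
  set K := |C| + ‖y‖ + 1
  have hK : 0 < K := by positivity
  obtain ⟨m, hms, hm⟩ := Metric.mem_closure_iff.1 (hs ℓ) (ε / (2 * K)) (by positivity)
  obtain ⟨N, hN⟩ := Metric.tendsto_atTop.1 (h m hms) (ε / 2) (by positivity)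
  refine ⟨N, fun k hk => ?_⟩
  have h1 := hN k hk
  rw [dist_eq_norm] at h1 hm ⊢
  have h2 : ‖(ℓ - m) (x k - y)‖ ≤ ‖ℓ - m‖ * ‖x k - y‖ := (ℓ - m).le_opNorm _
  have h3 : ‖x k - y‖ ≤ K := by
    have := norm_sub_le (x k) y
    have := hx k
    have := le_abs_self C
    simp only [K]; linarith
  have h4 : ℓ (x k) - ℓ y = (ℓ - m) (x k - y) + (m (x k) - m y) := by
    simp
  calc ‖ℓ (x k) - ℓ y‖ ≤ ‖(ℓ - m) (x k - y)‖ + ‖m (x k) - m y‖ := by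
        rw [h4]; exact norm_add_le _ _
    _ < ε / (2 * K) * K + ε / 2 := by
        refine add_lt_add_of_le_of_lt (h2.trans ?_) h1
        exact mul_le_mul hm.le h3 (norm_nonneg _) (by positivity)
    _ = ε := by field_simp; norm_num

end Weak

/-! ### Affine rescaling, and the passage from global to local closedness -/

section Affine

variable {n : ℕ}

/-- The affine homeomorphism `y ↦ a + r y` of `ℝⁿ`. -/
def affine (a : Pt n) (r : ℝ) (hr : 0 < r) : Pt n ≃ₜ Pt n :=
  (Homeomorph.smulOfNeZero r hr.ne').trans (Homeomorph.addLeft a)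

theorem affine_apply (a : Pt n) {r : ℝ} (hr : 0 < r) (y : Pt n) : affine a r hr y = a + r • y := rfl

theorem affine_symm_apply (a : Pt n) {r : ℝ} (hr : 0 < r) (x : Pt n) :
    (affine a r hr).symm x = r⁻¹ • (x - a) := by
  rw [Homeomorph.symm_apply_eq, affine_apply, smul_inv_smul₀ hr.ne', add_sub_cancel]

/-- The factor by which `y ↦ a + r y` compresses Lebesgue measure. -/
def affineFactor (n : ℕ) (r : ℝ) : ℝ := |(r ^ n)⁻¹|

theorem affineFactor_pos (n : ℕ) {r : ℝ} (hr : 0 < r) : 0 < affineFactor n r := by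
  unfold affineFactor; positivity

theorem map_affine (a : Pt n) {r : ℝ} (hr : 0 < r) :
    (volume : Measure (Pt n)).map (affine a r hr) = ENNReal.ofReal (affineFactor n r) • volume := by
  have h : (affine a r hr : Pt n → Pt n) = (a + ·) ∘ (r • ·) := rfl
  rw [h, ← Measure.map_map (measurable_const_add a) (measurable_const_smul r),
    Measure.map_addHaar_smul _ hr.ne', Measure.map_smul, map_add_left_eq_self,
    finrank_euclideanSpace_fin, affineFactor]

theorem map_affine_restrict_le (a : Pt n) {r : ℝ} (hr : 0 < r) {s t : Set (Pt n)}
    (ht : MeasurableSet t) (h : Set.MapsTo (affine a r hr) s t) :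
    ((volume : Measure (Pt n)).restrict s).map (affine a r hr) ≤
      ENNReal.ofReal (affineFactor n r) • volume.restrict t := by
  rw [← Measure.restrict_smul, ← map_affine a hr,
    Measure.restrict_map (affine a r hr).measurable ht]
  exact Measure.map_mono (Measure.restrict_mono_set _ h) (affine a r hr).measurable

theorem integral_comp_affine_symm (a : Pt n) {r : ℝ} (hr : 0 < r) (h : Pt n → ℝ) :
    ∫ x, h ((affine a r hr).symm x) = (affineFactor n r)⁻¹ * ∫ y, h y := by
  have h1 : ∫ x, h ((affine a r hr).symm x) ∂((volume : Measure (Pt n)).map (affine a r hr)) =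
      ∫ y, h y := by
    rw [(affine a r hr).measurableEmbedding.integral_map]
    simp
  rw [map_affine, integral_smul_measure, ENNReal.toReal_ofReal (affineFactor_pos n hr).le,
    smul_eq_mul] at h1
  rw [← h1, inv_mul_cancel_left₀ (affineFactor_pos n hr).ne']

variable {V : Type*} [NormedAddCommGroup V] [NormedSpace ℝ V] {Ω ω : Opens (Pt n)}

/-- Transport of a test function along `y ↦ a + r y`, with a scalar factor. -/
def pushTest (a : Pt n) {r : ℝ} (hr : 0 < r)
    (h : Set.MapsTo (affine a r hr) (ω : Set (Pt n)) Ω) (t : ℝ) (φ : TestFunction ω V ⊤) :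
    TestFunction Ω V ⊤ where
  toFun x := t • φ ((affine a r hr).symm x)
  contDiff' := by
    have : ContDiff ℝ (⊤ : ℕ∞) fun x : Pt n => (affine a r hr).symm x := by
      simp_rw [affine_symm_apply]
      fun_prop
    exact (φ.contDiff.comp this).const_smul t
  hasCompactSupport' :=
    (φ.hasCompactSupport.comp_homeomorph (affine a r hr).symm).smul_left (f := fun _ => t)
  tsupport_subset' := by
    refine (tsupport_smul_subset_right (fun _ => t) _).trans ?_
    have : tsupport (fun x => φ ((affine a r hr).symm x)) ⊆
        (affine a r hr).symm ⁻¹' tsupport φ :=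
      closure_minimal (fun x hx => subset_tsupport _ hx)
        ((isClosed_tsupport _).preimage (affine a r hr).symm.continuous)
    intro x hx
    have := h (φ.tsupport_subset (this hx))
    rwa [Homeomorph.apply_symm_apply] at this

theorem fderiv_pushTest (a : Pt n) {r : ℝ} (hr : 0 < r)
    (h : Set.MapsTo (affine a r hr) (ω : Set (Pt n)) Ω) (t : ℝ) (φ : TestFunction ω V ⊤)
    (x : Pt n) :
    fderiv ℝ (pushTest a hr h t φ) x = (t * r⁻¹) • fderiv ℝ φ ((affine a r hr).symm x) := by
  have h1 : HasFDerivAt (fun x => (affine a r hr).symm x) (r⁻¹ • ContinuousLinearMap.id ℝ (Pt n))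
      x := by
    simp_rw [affine_symm_apply]
    exact ((hasFDerivAt_id x).sub_const a).const_smul r⁻¹
  have h2 : HasFDerivAt φ (fderiv ℝ φ ((affine a r hr).symm x)) ((affine a r hr).symm x) :=
    ((φ.contDiff.differentiable (by simp)) _).hasFDerivAt
  have h3 := (h2.comp x h1).const_smul t
  have h4 : fderiv ℝ (pushTest a hr h t φ) x = _ := h3.fderiv
  rw [h4]
  ext v
  simp [mul_smul]

/-- A change of variables moves the dilation onto the test function. The free factor `t` serves to
bring the transported test function into the Sobolev unit ball. -/
theorem firstOrder_comp_affine (b : Mat n →L[ℝ] (Pt n →L[ℝ] V) →L[ℝ] ℝ) (a : Pt n) {r : ℝ}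
    (hr : 0 < r) (h : Set.MapsTo (affine a r hr) (ω : Set (Pt n)) Ω) {t : ℝ} (ht : t ≠ 0)
    (F : Pt n → Mat n) (φ : TestFunction ω V ⊤) :
    firstOrder b (F ∘ affine a r hr) φ =
      (t * r⁻¹ * (affineFactor n r)⁻¹)⁻¹ * firstOrder b F (pushTest a hr h t φ) := by
  set H : Pt n → ℝ := fun y => b (F (affine a r hr y)) (fderiv ℝ φ y)
  -- Since `φ` is supported in `ω`, the integrals over `ω` and over `Ω` both extend to the whole
  -- space, where the change of variables is exact.
  have hH : ∀ y ∉ (ω : Set (Pt n)), H y = 0 := fun y hy => by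
    have : fderiv ℝ φ y = 0 := fderiv_of_notMem_tsupport _ fun h' => hy (φ.tsupport_subset h')
    simp [H, this]
  have h1 : ∀ x, b (F x) (fderiv ℝ (pushTest a hr h t φ) x) =
      (t * r⁻¹) * H ((affine a r hr).symm x) := fun x => by
    simp only [H, fderiv_pushTest, map_smul, Homeomorph.apply_symm_apply, smul_eq_mul]
  unfold firstOrder
  simp_rw [h1]
  rw [integral_const_mul, setIntegral_eq_integral_of_forall_compl_eq_zero (s := (Ω : Set (Pt n))),
    integral_comp_affine_symm, mul_neg]
  · congr 1
    change ∫ x in (ω : Set (Pt n)), H x = _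
    rw [setIntegral_eq_integral_of_forall_compl_eq_zero hH]
    have := (affineFactor_pos n hr).ne'
    field_simp
  · intro x hx
    refine hH _ fun h' => hx ?_
    have := h h'
    rwa [Homeomorph.apply_symm_apply] at this

/-- Rescaling a test function changes its Sobolev norm by a bounded factor. -/
theorem exists_sobolevNorm_pushTest_le (a : Pt n) {r : ℝ} (hr : 0 < r)
    (h : Set.MapsTo (affine a r hr) (ω : Set (Pt n)) Ω) (q : ℝ≥0∞) :
    ∃ t : ℝ, 0 < t ∧ ∀ φ : TestFunction ω V ⊤, sobolevNorm q φ ≤ 1 →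
      sobolevNorm q (pushTest a hr h t φ) ≤ 1 := by
  set C : ℝ≥0∞ := (ENNReal.ofReal (affineFactor n r)⁻¹) ^ (1 / q).toReal
  have hC : C ≠ ∞ := ENNReal.rpow_ne_top_of_nonneg (by positivity) ENNReal.ofReal_ne_top
  have hmap : (volume : Measure (Pt n)).map (affine a r hr).symm ≤
      ENNReal.ofReal (affineFactor n r)⁻¹ • volume := by
    have h1 : (volume : Measure (Pt n)) = ENNReal.ofReal (affineFactor n r)⁻¹ •
        (volume : Measure (Pt n)).map (affine a r hr) := by
      rw [map_affine, smul_smul, ← ENNReal.ofReal_mul (inv_nonneg.2 (affineFactor_pos n hr).le),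
        inv_mul_cancel₀ (affineFactor_pos n hr).ne', ENNReal.ofReal_one, one_smul]
    conv_lhs => rw [h1]
    rw [Measure.map_smul, Measure.map_map (affine a r hr).symm.measurable
      (affine a r hr).measurable]
    simp
  have key : ∀ {W : Type _} [NormedAddCommGroup W] (g : Pt n → W), Continuous g →
      Function.support g ⊆ ω →
      eLpNorm (fun x => g ((affine a r hr).symm x)) q (volume.restrict (Ω : Set (Pt n))) ≤
        C * eLpNorm g q (volume.restrict (ω : Set (Pt n))) := by
    intro W _ g hg hs
    rw [eLpNorm_restrict_eq_of_support_subset hs]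
    refine (eLpNorm_mono_measure _ Measure.restrict_le_self).trans ?_
    exact eLpNorm_comp_le (affine a r hr).symm.measurable hmap hg.aestronglyMeasurable q
  -- Composition costs `C` for the function and `C / r` for its derivative; dividing by `K` absorbs
  -- both, and the summand `1` keeps `K` positive.
  set K : ℝ := 1 + C.toReal * (1 + r⁻¹)
  have hK : 1 ≤ K := le_add_of_nonneg_right (by positivity)
  have hK0 : 0 < K := by linarith
  refine ⟨K⁻¹, by positivity, fun φ hφ => ?_⟩
  have hD : Continuous (fderiv ℝ φ) := φ.contDiff.continuous_fderiv (by simp)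
  have e1 : (pushTest a hr h K⁻¹ φ : Pt n → V) =
      K⁻¹ • fun x => φ ((affine a r hr).symm x) := rfl
  have e2 : fderiv ℝ (pushTest a hr h K⁻¹ φ) =
      (K⁻¹ * r⁻¹) • fun x => fderiv ℝ φ ((affine a r hr).symm x) :=
    funext fun x => fderiv_pushTest a hr h _ φ x
  have k1 := key φ φ.continuous ((subset_tsupport _).trans φ.tsupport_subset)
  have k2 := key (fderiv ℝ φ) hD ((support_fderiv_subset ℝ).trans φ.tsupport_subset)
  have l1 : eLpNorm φ q (volume.restrict (ω : Set (Pt n))) ≤ 1 := le_self_add.trans hφ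
  have l2 : eLpNorm (fderiv ℝ φ) q (volume.restrict (ω : Set (Pt n))) ≤ 1 := le_add_self.trans hφ
  unfold sobolevNorm
  rw [e2, e1, eLpNorm_const_smul, eLpNorm_const_smul, Real.enorm_of_nonneg (by positivity),
    Real.enorm_of_nonneg (by positivity)]
  calc _ ≤ ENNReal.ofReal K⁻¹ * (C * 1) + ENNReal.ofReal (K⁻¹ * r⁻¹) * (C * 1) := by
        gcongr
        · exact k1.trans (by gcongr)
        · exact k2.trans (by gcongr)
    _ = ENNReal.ofReal (K⁻¹ * (C.toReal * (1 + r⁻¹))) := by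
        rw [mul_one, ← add_mul, ← ENNReal.ofReal_add (by positivity) (by positivity),
          ← ENNReal.ofReal_toReal hC, ← ENNReal.ofReal_mul (by positivity),
          ENNReal.toReal_ofReal (by positivity)]
        congr 1
        ring
    _ ≤ 1 := by
        rw [← ENNReal.ofReal_one]
        refine ENNReal.ofReal_le_ofReal ?_
        rw [inv_mul_le_iff₀ hK0]
        simp only [K]
        linarith

/-- Rescaling is bounded with respect to the `W^{-1,p}` norms of first order operators. -/
theorem exists_negSobolevNorm_comp_affine_le (b : Mat n →L[ℝ] (Pt n →L[ℝ] V) →L[ℝ] ℝ) (a : Pt n)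
    {r : ℝ} (hr : 0 < r) (h : Set.MapsTo (affine a r hr) (ω : Set (Pt n)) Ω) (p : ℝ≥0∞) :
    ∃ c : ℝ≥0∞, c ≠ ∞ ∧ ∀ F G : Pt n → Mat n,
      negSobolevNorm p (fun φ : TestFunction ω V ⊤ =>
          firstOrder b (F ∘ affine a r hr) φ - firstOrder b (G ∘ affine a r hr) φ) ≤
        c * negSobolevNorm p (fun φ : TestFunction Ω V ⊤ => firstOrder b F φ - firstOrder b G φ) := by
  obtain ⟨t, ht, hφ⟩ := exists_sobolevNorm_pushTest_le (V := V) a hr h p.conjExponent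
  set c := (t * r⁻¹ * (affineFactor n r)⁻¹)⁻¹
  have hc : 0 ≤ c := by have := affineFactor_pos n hr; positivity
  refine ⟨ENNReal.ofReal c, ENNReal.ofReal_ne_top, fun F G => iSup₂_le fun φ h1 => ?_⟩
  beta_reduce
  rw [firstOrder_comp_affine b a hr h ht.ne', firstOrder_comp_affine b a hr h ht.ne', ← mul_sub,
    abs_mul, abs_of_nonneg hc, ENNReal.ofReal_mul hc]
  gcongr
  exact le_iSup₂ (f := fun (φ : TestFunction Ω V ⊤) (_ : sobolevNorm p.conjExponent φ ≤ 1) =>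
    ENNReal.ofReal |firstOrder b F φ - firstOrder b G φ|) _ (hφ φ h1)

/-- Rescaling of states: `(F, P) ↦ (F (a + r ·), P (a + r ·))`. -/
def rescale (p q : ℝ≥0∞) [Fact (1 ≤ p)] [Fact (1 ≤ q)] (a : Pt n) {r : ℝ} (hr : 0 < r)
    (h : Set.MapsTo (affine a r hr) (ω : Set (Pt n)) Ω) :
    PhaseSpace p q Ω →L[ℝ] PhaseSpace p q ω :=
  (compL (Mat n) p (affine a r hr).measurable ENNReal.ofReal_ne_top
    (map_affine_restrict_le a hr Ω.isOpen.measurableSet h)).prodMap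
  (compL (Mat n) q (affine a r hr).measurable ENNReal.ofReal_ne_top
    (map_affine_restrict_le a hr Ω.isOpen.measurableSet h))

variable {p q : ℝ≥0∞} [Fact (1 ≤ p)] [Fact (1 ≤ q)]

theorem rescale_fst_coeFn (a : Pt n) {r : ℝ} (hr : 0 < r)
    (h : Set.MapsTo (affine a r hr) (ω : Set (Pt n)) Ω) (z : PhaseSpace p q Ω) :
    (rescale p q a hr h z).1 =ᵐ[volume.restrict (ω : Set (Pt n))] z.1 ∘ affine a r hr :=
  compL_coeFn (affine a r hr).measurable ENNReal.ofReal_ne_top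
    (map_affine_restrict_le a hr Ω.isOpen.measurableSet h) z.1

theorem rescale_snd_coeFn (a : Pt n) {r : ℝ} (hr : 0 < r)
    (h : Set.MapsTo (affine a r hr) (ω : Set (Pt n)) Ω) (z : PhaseSpace p q Ω) :
    (rescale p q a hr h z).2 =ᵐ[volume.restrict (ω : Set (Pt n))] z.2 ∘ affine a r hr :=
  compL_coeFn (affine a r hr).measurable ENNReal.ofReal_ne_top
    (map_affine_restrict_le a hr Ω.isOpen.measurableSet h) z.2

theorem ae_comp_affine (a : Pt n) {r : ℝ} (hr : 0 < r)
    (h : Set.MapsTo (affine a r hr) (ω : Set (Pt n)) Ω) {P : Pt n → Prop}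
    (hP : ∀ᵐ x ∂(volume.restrict (Ω : Set (Pt n))), P x) :
    ∀ᵐ y ∂(volume.restrict (ω : Set (Pt n))), P (affine a r hr y) :=
  ae_of_ae_map (affine a r hr).measurable.aemeasurable
    (((map_affine_restrict_le a hr Ω.isOpen.measurableSet h).absolutelyContinuous.trans
      Measure.smul_absolutelyContinuous).ae_le hP)

theorem rescale_mem_dataSet (a : Pt n) {r : ℝ} (hr : 0 < r)
    (h : Set.MapsTo (affine a r hr) (ω : Set (Pt n)) Ω) {Dloc : Set (Mat n × Mat n)}
    {z : PhaseSpace p q Ω} (hz : z ∈ dataSet p q Ω Dloc) :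
    rescale p q a hr h z ∈ dataSet p q ω Dloc := by
  filter_upwards [rescale_fst_coeFn a hr h z, rescale_snd_coeFn a hr h z,
    ae_comp_affine a hr h hz] with y h1 h2 h3
  rw [h1, h2]
  exact h3

/-- Div-curl convergence is stable under rescaling and restriction. -/
theorem DivCurlTendsto.rescale {z : ℕ → PhaseSpace p q Ω} {w : PhaseSpace p q Ω}
    (hz : DivCurlTendsto z w) (a : Pt n) {r : ℝ} (hr : 0 < r)
    (h : Set.MapsTo (affine a r hr) (ω : Set (Pt n)) Ω) :
    DivCurlTendsto (fun k => rescale p q a hr h (z k)) (rescale p q a hr h w) := by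
  obtain ⟨hw, hc, hd⟩ := hz
  refine ⟨tendsto_toWeakSpace_map hw _, ?_, ?_⟩
  · obtain ⟨c, hcf, hle⟩ := exists_negSobolevNorm_comp_affine_le (curlForm n) a hr h p
    simp_rw [curl_eq_firstOrder, firstOrder_congr _ (rescale_fst_coeFn a hr h _)]
    simp_rw [curl_eq_firstOrder] at hc
    have := ENNReal.Tendsto.const_mul (a := c) hc (Or.inr hcf)
    rw [mul_zero] at this
    exact tendsto_of_tendsto_of_tendsto_of_le_of_le tendsto_const_nhds this
      (fun _ => zero_le) fun k => hle _ _
  · obtain ⟨c, hcf, hle⟩ := exists_negSobolevNorm_comp_affine_le (divForm n) a hr h q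
    simp_rw [div_eq_firstOrder, firstOrder_congr _ (rescale_snd_coeFn a hr h _)]
    simp_rw [div_eq_firstOrder] at hd
    have := ENNReal.Tendsto.const_mul (a := c) hd (Or.inr hcf)
    rw [mul_zero] at this
    exact tendsto_of_tendsto_of_tendsto_of_le_of_le tendsto_const_nhds this
      (fun _ => zero_le) fun k => hle _ _

/-- A div-curl-closed data set on one bounded domain is locally div-curl-closed. -/
theorem isLocallyDivCurlClosed_of_isDivCurlClosed (hne : (Ω : Set (Pt n)).Nonempty)
    (hbd : Bornology.IsBounded (Ω : Set (Pt n))) {Dloc : Set (Mat n × Mat n)}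
    (hD : IsDivCurlClosed (dataSet p q Ω Dloc)) : IsLocallyDivCurlClosed p q Dloc := by
  intro ω ⟨a, ha⟩ _ F₀ P₀ z w hw hz hzw
  obtain ⟨ρ, hρ, hball⟩ := Metric.isOpen_iff.1 ω.isOpen a ha
  obtain ⟨R, hR, hΩ⟩ := hbd.exists_pos_norm_lt
  -- `Ω` lies in the ball of radius `R` about the origin, so this ratio sends it into the ball of
  -- radius `ρ` about `a`.
  have hr : 0 < ρ / R := div_pos hρ hR
  have hmaps : Set.MapsTo (affine a (ρ / R) hr) (Ω : Set (Pt n)) ω := by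
    intro y hy
    refine hball ?_
    rw [affine_apply, mem_ball_iff_norm, add_sub_cancel_left, norm_smul,
      Real.norm_of_nonneg hr.le, div_mul_eq_mul_div, div_lt_iff₀ hR]
    exact mul_lt_mul_of_pos_left (hΩ y hy) hρ
  have hmem := hD _ _ (fun k => rescale_mem_dataSet a hr hmaps (hz k)) (hzw.rescale a hr hmaps)
  have hne' : (ae (volume.restrict (Ω : Set (Pt n)))).NeBot := by
    rw [ae_neBot, Ne, Measure.restrict_eq_zero]
    exact (Ω.isOpen.measure_pos _ hne).ne'
  obtain ⟨y, h1, h2, h3, h4⟩ := (((rescale_fst_coeFn a hr hmaps w).and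
    ((rescale_snd_coeFn a hr hmaps w).and ((ae_comp_affine a hr hmaps hw).and hmem)))).exists
  rw [h1, h2, Function.comp_apply, Function.comp_apply, h3.1, h3.2] at h4
  exact h4

end Affine

/-! ### Fatou argument and averages over small balls -/

section Averages

/-- A double Fatou argument: a double sequence that is bounded in `L¹` stays bounded at almost
every point along suitable indices, along which the small sequence `d` is small as well. -/
theorem ae_exists_frequently_le {X : Type*} [MeasurableSpace X] {μ : Measure X}
    {a : ℕ → ℕ → X → ℝ≥0∞} {d : ℕ → X → ℝ≥0∞} (ha : ∀ m k, Measurable (a m k))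
    (hd : ∀ m, Measurable (d m)) {M : ℝ≥0∞} (hM : M ≠ ∞) (haM : ∀ m k, ∫⁻ x, a m k x ∂μ ≤ M)
    (hd1 : ∀ m : ℕ, m * ∫⁻ x, d m x ∂μ ≤ 1) :
    ∀ᵐ x ∂μ, ∃ K : ℝ≥0∞, K ≠ ∞ ∧ ∀ ε : ℝ≥0∞, 0 < ε →
      ∃ᶠ m in atTop, d m x ≤ ε ∧ ∃ᶠ k in atTop, a m k x ≤ K := by
  -- The weight `m` is the largest that `hd1` allows. Where `liminf u` is finite, `u m x < K` for
  -- infinitely many `m`, which bounds the inner liminf and gives `d m x ≤ K / m`.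
  set u : ℕ → X → ℝ≥0∞ := fun m x => liminf (fun k => a m k x) atTop + m * d m x
  have hum : ∀ m, Measurable (u m) := fun m =>
    (Measurable.liminf (ha m)).add ((hd m).const_mul _)
  have hu : ∀ m, ∫⁻ x, u m x ∂μ ≤ M + 1 := fun m => by
    simp only [u]
    rw [lintegral_add_right _ ((hd m).const_mul _), lintegral_const_mul _ (hd m)]
    refine add_le_add ((lintegral_liminf_le (ha m)).trans ?_) (hd1 m)
    exact liminf_le_of_frequently_le' (Frequently.of_forall (haM m))
  have hlim : ∫⁻ x, liminf (fun m => u m x) atTop ∂μ ≤ M + 1 :=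
    (lintegral_liminf_le hum).trans (liminf_le_of_frequently_le' (Frequently.of_forall hu))
  filter_upwards [ae_lt_top (Measurable.liminf hum)
    (hlim.trans_lt (ENNReal.add_lt_top.2 ⟨hM.lt_top, ENNReal.one_lt_top⟩)).ne] with x hx
  obtain ⟨K, hK1, hK2⟩ := exists_between hx
  refine ⟨K, hK2.ne, fun ε hε => ?_⟩
  have hfreq : ∃ᶠ m in atTop, u m x < K := frequently_lt_of_liminf_lt (by isBoundedDefault) hK1
  obtain ⟨N, hN⟩ := ENNReal.exists_nat_gt (ENNReal.div_lt_top hK2.ne hε.ne').ne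
  refine (hfreq.and_eventually ((eventually_ge_atTop N).and (eventually_gt_atTop 0))).mono ?_
  rintro m ⟨hm, hmN, hm0⟩
  constructor
  · have h1 : m * d m x ≤ K := le_add_self.trans hm.le
    have h2 : K / ε ≤ m := hN.le.trans (by exact_mod_cast hmN)
    rcases eq_or_ne ε ∞ with rfl | hε'
    · exact le_top
    have h3 : K ≤ m * ε := (ENNReal.div_le_iff hε.ne' hε').1 h2
    have hm' : (m : ℝ≥0∞) ≠ 0 := by exact_mod_cast hm0.ne'
    exact (ENNReal.mul_le_mul_iff_right hm' (ENNReal.natCast_ne_top m)).1 (h1.trans h3)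
  · have h1 : liminf (fun k => a m k x) atTop < K := le_self_add.trans_lt hm
    exact (frequently_lt_of_liminf_lt (by isBoundedDefault) h1).mono fun k hk => hk.le

variable {n : ℕ} {E : Type*} [NormedAddCommGroup E]

/-- The unit ball of `ℝⁿ`. -/
def unitBall (n : ℕ) : Opens (Pt n) := ⟨Metric.ball 0 1, Metric.isOpen_ball⟩

theorem volume_unitBall_ne_top : volume (unitBall n : Set (Pt n)) ≠ ∞ :=
  measure_ball_lt_top.ne

theorem measurable_average {g : Pt n × Pt n → ℝ≥0∞} (hg : Measurable g) :
    Measurable fun x => ∫⁻ y in (unitBall n : Set (Pt n)), g (x, y) :=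
  hg.lintegral_prod_right'

theorem lintegral_average_comp {g : Pt n → ℝ≥0∞} (hg : Measurable g) (r : ℝ) :
    ∫⁻ x, ∫⁻ y in (unitBall n : Set (Pt n)), g (x + r • y) =
      (∫⁻ x, g x) * volume (unitBall n : Set (Pt n)) := by
  rw [lintegral_lintegral_swap]
  · simp_rw [lintegral_add_right_eq_self]
    rw [setLIntegral_const]
  · refine Measurable.aemeasurable ?_
    exact hg.comp (measurable_fst.add (measurable_snd.const_smul r))

/-- Continuity of translations in `L^p`, obtained from the continuous action of the translation
group. -/
theorem tendsto_eLpNorm_translate_sub {p : ℝ≥0∞} (hp1 : 1 ≤ p) (hp : p ≠ ∞) {f : Pt n → E}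
    (hf : MemLp f p volume) :
    Tendsto (fun t => eLpNorm (fun x => f (x + t) - f x) p volume) (𝓝 0) (𝓝 0) := by
  have : Fact (1 ≤ p) := ⟨hp1⟩
  have : Fact (p ≠ ∞) := ⟨hp⟩
  have h1 : Continuous fun t : Pt n => DomAddAct.mk t +ᵥ hf.toLp f :=
    (DomAddAct.continuous_mk).vadd continuous_const
  have h2 := (h1.tendsto 0).edist (tendsto_const_nhds (x := hf.toLp f))
  have h3 : DomAddAct.mk (0 : Pt n) +ᵥ hf.toLp f = hf.toLp f := zero_vadd _ _
  rw [h3, edist_self] at h2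
  refine h2.congr fun t => ?_
  rw [Lp.edist_def]
  refine eLpNorm_congr_ae ?_
  filter_upwards [DomAddAct.vadd_Lp_ae_eq (DomAddAct.mk t) (hf.toLp f), hf.coeFn_toLp,
    (measurePreserving_add_right volume t).quasiMeasurePreserving.ae hf.coeFn_toLp]
    with x h4 h5 h6
  rw [Pi.sub_apply, h4, h5, ← h6]
  simp [add_comm]

/-- The mean oscillation over small balls of an `L^p` function tends to zero in `L^1`. -/
theorem exists_lintegral_oscillation_le {p : ℝ≥0∞} (hp1 : 1 ≤ p) (hp : p ≠ ∞) {f : Pt n → E}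
    (hfm : StronglyMeasurable f) (hf : MemLp f p volume) {ε : ℝ≥0∞} (hε : 0 < ε) :
    ∃ δ : ℝ, 0 < δ ∧ ∀ r : ℝ, 0 < r → r ≤ δ →
      ∫⁻ x, ∫⁻ y in (unitBall n : Set (Pt n)), ‖f (x + r • y) - f x‖ₑ ^ p.toReal ≤ ε := by
  have hp0 : p ≠ 0 := (zero_lt_one.trans_le hp1).ne'
  have hpr : 0 < p.toReal := ENNReal.toReal_pos hp0 hp
  have h1 : Tendsto (fun t => ∫⁻ x, ‖f (x + t) - f x‖ₑ ^ p.toReal) (𝓝 0) (𝓝 0) := by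
    have := (tendsto_eLpNorm_translate_sub hp1 hp hf).ennrpow_const p.toReal
    rw [ENNReal.zero_rpow_of_pos hpr] at this
    refine this.congr fun t => ?_
    rw [eLpNorm_eq_lintegral_rpow_enorm_toReal hp0 hp, ← ENNReal.rpow_mul, one_div,
      inv_mul_cancel₀ hpr.ne', ENNReal.rpow_one]
  have hB : volume (unitBall n : Set (Pt n)) ≠ ∞ := volume_unitBall_ne_top
  have hη : 0 < ε / volume (unitBall n : Set (Pt n)) := ENNReal.div_pos hε.ne' hB
  obtain ⟨δ, hδ, hball⟩ := Metric.eventually_nhds_iff_ball.1 (h1.eventually (ge_mem_nhds hη))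
  refine ⟨δ, hδ, fun r hr hrδ => ?_⟩
  rw [lintegral_lintegral_swap]
  · refine (setLIntegral_mono measurable_const fun y hy => hball (r • y) ?_).trans ?_
    · have hy' : ‖y‖ < 1 := mem_ball_zero_iff.1 hy
      rw [mem_ball_zero_iff, norm_smul, Real.norm_of_nonneg hr.le]
      nlinarith [norm_nonneg y]
    · rw [setLIntegral_const]
      exact ENNReal.mul_le_of_le_div le_rfl
  · refine Measurable.aemeasurable ?_
    refine Measurable.pow_const ?_ _
    refine StronglyMeasurable.enorm ?_
    exact (hfm.comp_measurable (measurable_fst.add (measurable_snd.const_smul r))).sub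
      (hfm.comp_measurable measurable_fst)

theorem lintegral_rpow_indicator {Ω : Opens (Pt n)} {p : ℝ≥0∞} (hp1 : 1 ≤ p) (hp : p ≠ ∞)
    (f : Pt n → E) :
    ∫⁻ x, ‖(Ω : Set (Pt n)).indicator f x‖ₑ ^ p.toReal =
      eLpNorm f p (volume.restrict (Ω : Set (Pt n))) ^ p.toReal := by
  have hp0 : p ≠ 0 := (zero_lt_one.trans_le hp1).ne'
  rw [← eLpNorm_indicator_eq_eLpNorm_restrict Ω.isOpen.measurableSet,
    eLpNorm_eq_lintegral_rpow_enorm_toReal hp0 hp, ← ENNReal.rpow_mul, one_div,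
    inv_mul_cancel₀ (ENNReal.toReal_pos hp0 hp).ne', ENNReal.rpow_one]

end Averages

/-! ### Blow-up, and the passage from local to global closedness -/

section Localization

variable {n : ℕ} {p q : ℝ≥0∞} [Fact (1 ≤ p)] [Fact (1 ≤ q)] {Ω ω : Opens (Pt n)}

theorem separableSpace_dual_phaseSpace (hp : 1 < p) (hp' : p < ∞) (hq : 1 < q) (hq' : q < ∞)
    (hω : volume (ω : Set (Pt n)) ≠ ∞) : SeparableSpace (PhaseSpace p q ω →L[ℝ] ℝ) := by
  have : IsFiniteMeasure (volume.restrict (ω : Set (Pt n))) := isFiniteMeasure_restrict.2 hω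
  have := separableSpace_dual_lp (μ := volume.restrict (ω : Set (Pt n))) hp hp'.ne (Fin n × Fin n)
  have := separableSpace_dual_lp (μ := volume.restrict (ω : Set (Pt n))) hq hq'.ne (Fin n × Fin n)
  let Φ : (Lp (Mat n) p (volume.restrict (ω : Set (Pt n))) →L[ℝ] ℝ) ×
      (Lp (Mat n) q (volume.restrict (ω : Set (Pt n))) →L[ℝ] ℝ) → (PhaseSpace p q ω →L[ℝ] ℝ) :=
    fun ℓ => ℓ.1.comp (ContinuousLinearMap.fst ℝ _ _) + ℓ.2.comp (ContinuousLinearMap.snd ℝ _ _)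
  have hΦ : Continuous Φ :=
    (continuous_fst.clm_comp continuous_const).add (continuous_snd.clm_comp continuous_const)
  have hs : Function.Surjective Φ := fun ℓ => by
    refine ⟨(ℓ.comp (ContinuousLinearMap.inl ℝ _ _), ℓ.comp (ContinuousLinearMap.inr ℝ _ _)), ?_⟩
    refine ContinuousLinearMap.ext fun z => ?_
    change ℓ (z.1, 0) + ℓ (0, z.2) = ℓ z
    rw [← map_add]
    simp
  exact hs.denseRange.separableSpace hΦ

/-- A bounded sequence that is asymptotically close, in the div-curl sense, to a norm convergent
sequence is div-curl-convergent. -/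
theorem divCurlTendsto_of_approx {Z U : ℕ → PhaseSpace p q ω} {W : PhaseSpace p q ω} {R : ℝ}
    (hZ : ∀ j, ‖Z j‖ ≤ R) (hU : Tendsto U atTop (𝓝 W))
    (hc : Tendsto (fun j => negSobolevNorm p
      (fun φ : TestFunction ω (Tens n) ⊤ => curl (Z j).1 φ - curl (U j).1 φ)) atTop (𝓝 0))
    (hd : Tendsto (fun j => negSobolevNorm q
      (fun φ : TestFunction ω (Pt n) ⊤ => div (Z j).2 φ - div (U j).2 φ)) atTop (𝓝 0))
    {s : Set (PhaseSpace p q ω →L[ℝ] ℝ)} (hs : Dense s)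
    (hℓ : ∀ ℓ ∈ s, Tendsto (fun j => ℓ (Z j) - ℓ (U j)) atTop (𝓝 0)) : DivCurlTendsto Z W := by
  -- Replacing `H j` by its norm limit costs at most `‖b‖ ‖H j - L‖` in the negative norm.
  have hbound : ∀ {r : ℝ≥0∞} [Fact (1 ≤ r)] {V : Type} [NormedAddCommGroup V] [NormedSpace ℝ V]
      (b : Mat n →L[ℝ] (Pt n →L[ℝ] V) →L[ℝ] ℝ)
      {G H : ℕ → Lp (Mat n) r (volume.restrict (ω : Set (Pt n)))}
      {L : Lp (Mat n) r (volume.restrict (ω : Set (Pt n)))}, Tendsto H atTop (𝓝 L) →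
      Tendsto (fun j => negSobolevNorm r
        (fun φ : TestFunction ω V ⊤ => firstOrder b (G j) φ - firstOrder b (H j) φ)) atTop (𝓝 0) →
      Tendsto (fun j => negSobolevNorm r
        (fun φ : TestFunction ω V ⊤ => firstOrder b (G j) φ - firstOrder b L φ)) atTop (𝓝 0) := by
    intro r hr V _ _ b G H L hH hG
    have h1 : Tendsto (fun j => ‖b‖ₑ * edist (H j) L) atTop (𝓝 0) := by
      have := ENNReal.Tendsto.const_mul (a := ‖b‖ₑ) (tendsto_iff_edist_tendsto_0.1 hH)
        (Or.inr enorm_ne_top)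
      rwa [mul_zero] at this
    have h2 := hG.add h1
    rw [add_zero] at h2
    refine tendsto_of_tendsto_of_tendsto_of_le_of_le tendsto_const_nhds h2
      (fun _ => zero_le) fun j => ?_
    have h3 : ∀ φ : TestFunction ω V ⊤, firstOrder b (G j) φ - firstOrder b L φ =
        (firstOrder b (G j) φ - firstOrder b (H j) φ) +
          (firstOrder b (H j) φ - firstOrder b L φ) := fun φ => by ring
    simp_rw [h3]
    refine (negSobolevNorm_add_le _ _ _).trans (add_le_add le_rfl ?_)
    rw [Lp.edist_def]
    exact negSobolevNorm_firstOrder_sub_le hr.out b (Lp.memLp _) (Lp.memLp _)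
  refine ⟨?_, ?_, ?_⟩
  · rw [tendsto_toWeakSpace_iff]
    refine tendsto_of_dense_functionals hZ hs fun ℓ h => ?_
    have h1 := (hℓ ℓ h).add ((ℓ.continuous.tendsto W).comp hU)
    rw [zero_add] at h1
    exact h1.congr fun j => by simp
  · simp_rw [curl_eq_firstOrder] at hc ⊢
    exact hbound (curlForm n) ((continuous_fst.tendsto W).comp hU) hc
  · simp_rw [div_eq_firstOrder] at hd ⊢
    exact hbound (divForm n) ((continuous_snd.tendsto W).comp hU) hd

/-- Translates the averages of zero extensions into norms of rescaled states: `c = 0` gives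
boundedness, `c = w(x)` gives convergence to the constant. -/
theorem eLpNorm_sub_const_of_ae_eq_comp_affine {r : ℝ≥0∞} (hr1 : 1 ≤ r) (hr' : r ≠ ∞) {x : Pt n}
    {ρ : ℝ} (hρ : 0 < ρ) (h : Set.MapsTo (affine x ρ hρ) (unitBall n : Set (Pt n)) Ω)
    {f g : Pt n → Mat n}
    (hg : g =ᵐ[volume.restrict (unitBall n : Set (Pt n))] f ∘ affine x ρ hρ) (c : Mat n)
    {K : ℝ≥0∞} (hK : ∫⁻ y in (unitBall n : Set (Pt n)),
      ‖(Ω : Set (Pt n)).indicator f (x + ρ • y) - c‖ₑ ^ r.toReal ≤ K) :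
    eLpNorm (fun y => g y - c) r (volume.restrict (unitBall n : Set (Pt n))) ≤
      K ^ (1 / r.toReal) := by
  rw [eLpNorm_eq_lintegral_rpow_enorm_toReal (zero_lt_one.trans_le hr1).ne' hr']
  refine ENNReal.rpow_le_rpow (le_trans (le_of_eq ?_) hK) (by positivity)
  refine lintegral_congr_ae ?_
  filter_upwards [hg, ae_restrict_mem (unitBall n).isOpen.measurableSet] with y h1 h2
  rw [h1, Function.comp_apply, ← affine_apply x hρ, Set.indicator_of_mem (h h2)]

/-- Radii along which the rescalings of a bounded sequence stay bounded and those of the limit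
converge, at almost every point. -/
theorem exists_radii (hp' : p < ∞) (hq' : q < ∞) {z : ℕ → PhaseSpace p q Ω} {C : ℝ}
    (hz : ∀ k, ‖z k‖ ≤ C) (w : PhaseSpace p q Ω) :
    ∃ r : ℕ → ℝ, (∀ m, 0 < r m) ∧ Tendsto r atTop (𝓝 0) ∧
      ∀ᵐ x : Pt n, ∃ K : ℝ≥0∞, K ≠ ∞ ∧ ∀ ε : ℝ≥0∞, 0 < ε → ∃ᶠ m in atTop,
        (∫⁻ y in (unitBall n : Set (Pt n)), ‖(Ω : Set (Pt n)).indicator w.1 (x + r m • y) -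
            (Ω : Set (Pt n)).indicator w.1 x‖ₑ ^ p.toReal) +
          (∫⁻ y in (unitBall n : Set (Pt n)), ‖(Ω : Set (Pt n)).indicator w.2 (x + r m • y) -
            (Ω : Set (Pt n)).indicator w.2 x‖ₑ ^ q.toReal) ≤ ε ∧
        ∃ᶠ k in atTop,
          (∫⁻ y in (unitBall n : Set (Pt n)),
            ‖(Ω : Set (Pt n)).indicator (z k).1 (x + r m • y)‖ₑ ^ p.toReal) +
          (∫⁻ y in (unitBall n : Set (Pt n)),
            ‖(Ω : Set (Pt n)).indicator (z k).2 (x + r m • y)‖ₑ ^ q.toReal) ≤ K := by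
  have hp1 : 1 ≤ p := Fact.out
  have hq1 : 1 ≤ q := Fact.out
  have hΩ := Ω.isOpen.measurableSet
  have hsm : ∀ {s : ℝ≥0∞} (f : Lp (Mat n) s (volume.restrict (Ω : Set (Pt n)))),
      StronglyMeasurable ((Ω : Set (Pt n)).indicator f) := fun f =>
    (Lp.stronglyMeasurable f).indicator hΩ
  have hmem : ∀ {s : ℝ≥0∞} (f : Lp (Mat n) s (volume.restrict (Ω : Set (Pt n)))),
      MemLp ((Ω : Set (Pt n)).indicator f) s volume := fun f =>
    (memLp_indicator_iff_restrict hΩ).2 (Lp.memLp f)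
  -- Half of `1 / (m + 1)` for each of the two components, so that `m` times the total oscillation
  -- is at most `1`.
  have hε : ∀ m : ℕ, 0 < (2 * ((m : ℝ≥0∞) + 1))⁻¹ := fun m => by
    rw [ENNReal.inv_pos]
    exact ENNReal.mul_ne_top (by simp) (by simp)
  choose δ₁ hδ₁ hosc₁ using fun m =>
    exists_lintegral_oscillation_le hp1 hp'.ne (hsm w.1) (hmem w.1) (hε m)
  choose δ₂ hδ₂ hosc₂ using fun m =>
    exists_lintegral_oscillation_le hq1 hq'.ne (hsm w.2) (hmem w.2) (hε m)
  let r : ℕ → ℝ := fun m => min (min (δ₁ m) (δ₂ m)) (1 / ((m : ℝ) + 1))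
  have hr : ∀ m, 0 < r m := fun m => lt_min (lt_min (hδ₁ m) (hδ₂ m)) (by positivity)
  have hr0 : Tendsto r atTop (𝓝 0) :=
    tendsto_of_tendsto_of_tendsto_of_le_of_le tendsto_const_nhds
      tendsto_one_div_add_atTop_nhds_zero_nat (fun m => (hr m).le) fun m => min_le_right _ _
  have hmavg : ∀ {s : ℝ≥0∞} (f : Lp (Mat n) s (volume.restrict (Ω : Set (Pt n)))) (m : ℕ),
      Measurable fun x => ∫⁻ y in (unitBall n : Set (Pt n)),
        ‖(Ω : Set (Pt n)).indicator f (x + r m • y)‖ₑ ^ s.toReal := fun {s} f m =>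
    measurable_average (g := fun xy => ‖(Ω : Set (Pt n)).indicator f (xy.1 + r m • xy.2)‖ₑ ^
      s.toReal) (((hsm f).comp_measurable
        (measurable_fst.add (measurable_snd.const_smul (r m)))).enorm.pow_const _)
  have hmosc : ∀ {s : ℝ≥0∞} (f : Lp (Mat n) s (volume.restrict (Ω : Set (Pt n)))) (m : ℕ),
      Measurable fun x => ∫⁻ y in (unitBall n : Set (Pt n)),
        ‖(Ω : Set (Pt n)).indicator f (x + r m • y) -
          (Ω : Set (Pt n)).indicator f x‖ₑ ^ s.toReal := fun {s} f m =>
    measurable_average (g := fun xy => ‖(Ω : Set (Pt n)).indicator f (xy.1 + r m • xy.2) -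
      (Ω : Set (Pt n)).indicator f xy.1‖ₑ ^ s.toReal)
        ((((hsm f).comp_measurable (measurable_fst.add (measurable_snd.const_smul (r m)))).sub
          ((hsm f).comp_measurable measurable_fst)).enorm.pow_const _)
  have havg : ∀ {s : ℝ≥0∞}, 1 ≤ s → s ≠ ∞ →
      ∀ (f : Lp (Mat n) s (volume.restrict (Ω : Set (Pt n)))) (m : ℕ), ‖f‖ ≤ C →
      ∫⁻ x, ∫⁻ y in (unitBall n : Set (Pt n)),
        ‖(Ω : Set (Pt n)).indicator f (x + r m • y)‖ₑ ^ s.toReal ≤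
      ENNReal.ofReal C ^ s.toReal * volume (unitBall n : Set (Pt n)) := by
    intro s hs1 hs' f m hf
    rw [lintegral_average_comp (g := fun x => ‖(Ω : Set (Pt n)).indicator f x‖ₑ ^ s.toReal)
      ((hsm f).enorm.pow_const _), lintegral_rpow_indicator hs1 hs']
    gcongr
    rw [← ENNReal.ofReal_toReal (Lp.eLpNorm_ne_top f), ← Lp.norm_def]
    exact ENNReal.ofReal_le_ofReal hf
  refine ⟨r, hr, hr0, ?_⟩
  have hB : volume (unitBall n : Set (Pt n)) ≠ ∞ := volume_unitBall_ne_top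
  refine ae_exists_frequently_le
    (a := fun m k x => (∫⁻ y in (unitBall n : Set (Pt n)),
            ‖(Ω : Set (Pt n)).indicator (z k).1 (x + r m • y)‖ₑ ^ p.toReal) +
          (∫⁻ y in (unitBall n : Set (Pt n)),
            ‖(Ω : Set (Pt n)).indicator (z k).2 (x + r m • y)‖ₑ ^ q.toReal))
    (d := fun m x => (∫⁻ y in (unitBall n : Set (Pt n)),
            ‖(Ω : Set (Pt n)).indicator w.1 (x + r m • y) -
              (Ω : Set (Pt n)).indicator w.1 x‖ₑ ^ p.toReal) +
          (∫⁻ y in (unitBall n : Set (Pt n)), ‖(Ω : Set (Pt n)).indicator w.2 (x + r m • y) -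
            (Ω : Set (Pt n)).indicator w.2 x‖ₑ ^ q.toReal))
    (M := ENNReal.ofReal C ^ p.toReal * volume (unitBall n : Set (Pt n)) +
      ENNReal.ofReal C ^ q.toReal * volume (unitBall n : Set (Pt n)))
    (fun m k => (hmavg _ m).add (hmavg _ m)) (fun m => (hmosc _ m).add (hmosc _ m)) ?_
    (fun m k => ?_) fun m => ?_
  · finiteness
  · rw [lintegral_add_left (hmavg _ m)]
    exact add_le_add (havg hp1 hp'.ne _ m ((norm_fst_le _).trans (hz k)))
      (havg hq1 hq'.ne _ m ((norm_snd_le _).trans (hz k)))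
  · rw [lintegral_add_left (hmosc _ m)]
    have h1 := hosc₁ m (r m) (hr m) ((min_le_left _ _).trans (min_le_left _ _))
    have h2 := hosc₂ m (r m) (hr m) ((min_le_left _ _).trans (min_le_right _ _))
    have h3 : (m : ℝ≥0∞) + 1 ≠ 0 := by simp
    have h4 : (m : ℝ≥0∞) + 1 ≠ ∞ := by simp
    calc _ ≤ ((m : ℝ≥0∞) + 1) * ((2 * ((m : ℝ≥0∞) + 1))⁻¹ + (2 * ((m : ℝ≥0∞) + 1))⁻¹) :=
          mul_le_mul' le_self_add (add_le_add h1 h2)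
      _ = 1 := by
          rw [ENNReal.mul_inv (Or.inl (by simp)) (Or.inl (by simp)), ← add_mul,
            ENNReal.inv_two_add_inv_two, one_mul, ENNReal.mul_inv_cancel h3 h4]

theorem exists_mapsTo_affine_unitBall {x : Pt n} (hx : x ∈ Ω) :
    ∃ ρ : ℝ, 0 < ρ ∧ ∀ (r : ℝ) (hr : 0 < r), r < ρ →
      Set.MapsTo (affine x r hr) (unitBall n : Set (Pt n)) Ω := by
  obtain ⟨ρ, hρ, hball⟩ := Metric.isOpen_iff.1 Ω.isOpen x hx
  refine ⟨ρ, hρ, fun r hr hrρ y hy => hball ?_⟩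
  have hy' : ‖y‖ < 1 := mem_ball_zero_iff.1 hy
  rw [affine_apply, mem_ball_iff_norm, add_sub_cancel_left, norm_smul, Real.norm_of_nonneg hr.le]
  nlinarith [norm_nonneg y]

/-- Blow-up at almost every `x ∈ Ω`: a diagonal choice of radius and index gives states on the unit
ball that div-curl-converge to the constant `w(x)`. -/
theorem isDivCurlClosed_of_isLocallyDivCurlClosed (hp : 1 < p) (hp' : p < ∞) (hq : 1 < q)
    (hq' : q < ∞) {Dloc : Set (Mat n × Mat n)} (hD : IsLocallyDivCurlClosed p q Dloc) :
    IsDivCurlClosed (dataSet p q Ω Dloc) := by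
  intro z w hz hzw
  obtain ⟨C, hC⟩ := exists_norm_le_of_tendsto_toWeakSpace hzw.1
  obtain ⟨r, hr, hr0, hae⟩ := exists_radii hp' hq' hC w
  have hfin : IsFiniteMeasure (volume.restrict (unitBall n : Set (Pt n))) :=
    isFiniteMeasure_restrict.2 volume_unitBall_ne_top
  have hsep := separableSpace_dual_phaseSpace (ω := unitBall n) hp hp' hq hq'
    volume_unitBall_ne_top
  have hp0 : 0 < p.toReal := ENNReal.toReal_pos (zero_lt_one.trans hp).ne' hp'.ne
  have hq0 : 0 < q.toReal := ENNReal.toReal_pos (zero_lt_one.trans hq).ne' hq'.ne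
  have : Nonempty (PhaseSpace p q (unitBall n) →L[ℝ] ℝ) := ⟨0⟩
  set ℓ := denseSeq (PhaseSpace p q (unitBall n) →L[ℝ] ℝ)
  filter_upwards [ae_restrict_of_ae hae, ae_restrict_mem Ω.isOpen.measurableSet] with x hx hxΩ
  obtain ⟨K, hK, hfreq⟩ := hx
  obtain ⟨ρ, hρ, hmaps⟩ := exists_mapsTo_affine_unitBall hxΩ
  set W : PhaseSpace p q (unitBall n) := (Lp.const p _ (w.1 x), Lp.const q _ (w.2 x))
  -- `K` was fixed before any tolerance, so this one bound serves the whole diagonal sequence.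
  set R : ℝ := max (K ^ (1 / p.toReal)).toReal (K ^ (1 / q.toReal)).toReal
  have step : ∀ j : ℕ, ∃ Z U : PhaseSpace p q (unitBall n), Z ∈ dataSet p q (unitBall n) Dloc ∧
      ‖Z‖ ≤ R ∧ ‖U - W‖ ≤ 1 / ((j : ℝ) + 1) ∧
      negSobolevNorm p (fun φ : TestFunction (unitBall n) (Tens n) ⊤ =>
        curl Z.1 φ - curl U.1 φ) ≤ ENNReal.ofReal (1 / ((j : ℝ) + 1)) ∧
      negSobolevNorm q (fun φ : TestFunction (unitBall n) (Pt n) ⊤ =>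
        div Z.2 φ - div U.2 φ) ≤ ENNReal.ofReal (1 / ((j : ℝ) + 1)) ∧
      ∀ i ≤ j, |ℓ i Z - ℓ i U| ≤ 1 / ((j : ℝ) + 1) := by
    intro j
    set ε : ℝ := 1 / ((j : ℝ) + 1)
    have hε : 0 < ε := by positivity
    have hε' : 0 < ENNReal.ofReal ε := ENNReal.ofReal_pos.2 hε
    -- The tolerance becomes at most `ε` after taking the `p`-th or the `q`-th root.
    obtain ⟨m, ⟨hosc, hk⟩, hm⟩ := ((hfreq (min (ENNReal.ofReal ε ^ p.toReal)
      (ENNReal.ofReal ε ^ q.toReal)) (lt_min (ENNReal.rpow_pos hε' ENNReal.ofReal_ne_top)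
        (ENNReal.rpow_pos hε' ENNReal.ofReal_ne_top))).and_eventually
          (hr0.eventually (gt_mem_nhds hρ))).exists
    have hmap := hmaps (r m) (hr m) hm
    obtain ⟨hw, hc, hd⟩ := hzw.rescale x (hr m) hmap
    rw [tendsto_toWeakSpace_iff] at hw
    have hℓ : ∀ᶠ k in atTop, ∀ i ≤ j, |ℓ i (rescale p q x (hr m) hmap (z k)) -
        ℓ i (rescale p q x (hr m) hmap w)| ≤ ε := by
      refine (Set.finite_Iic j).eventually_all.2 fun i _ => ?_
      filter_upwards [Metric.tendsto_nhds.1 (hw (ℓ i)) ε hε] with k hk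
      exact hk.le
    -- The radius is already fixed, so the rescaling constants, which may blow up as it shrinks, are
    -- harmless. The norm bound holds for infinitely many `k`, the other conditions for all large
    -- `k`.
    obtain ⟨k, hk, hck, hdk, hℓk⟩ := (hk.and_eventually ((hc.eventually (ge_mem_nhds hε')).and
      ((hd.eventually (ge_mem_nhds hε')).and hℓ))).exists
    refine ⟨rescale p q x (hr m) hmap (z k), rescale p q x (hr m) hmap w,
      rescale_mem_dataSet x (hr m) hmap (hz k), ?_, ?_, hck, hdk, hℓk⟩
    · refine max_le_max ?_ ?_
      · have h1 := eLpNorm_sub_const_of_ae_eq_comp_affine hp.le hp'.ne (hr m) hmap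
          (rescale_fst_coeFn x (hr m) hmap (z k)) 0 (K := K)
          (by simp_rw [sub_zero]; exact le_self_add.trans hk)
        simp_rw [sub_zero] at h1
        rw [Lp.norm_def]
        exact ENNReal.toReal_mono (ENNReal.rpow_ne_top_of_nonneg (by positivity) hK) h1
      · have h1 := eLpNorm_sub_const_of_ae_eq_comp_affine hq.le hq'.ne (hr m) hmap
          (rescale_snd_coeFn x (hr m) hmap (z k)) 0 (K := K)
          (by simp_rw [sub_zero]; exact le_add_self.trans hk)
        simp_rw [sub_zero] at h1
        rw [Lp.norm_def]
        exact ENNReal.toReal_mono (ENNReal.rpow_ne_top_of_nonneg (by positivity) hK) h1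
    · rw [Set.indicator_of_mem hxΩ, Set.indicator_of_mem hxΩ] at hosc
      refine max_le ?_ ?_
      · have h1 := eLpNorm_sub_const_of_ae_eq_comp_affine hp.le hp'.ne (hr m) hmap
          (rescale_fst_coeFn x (hr m) hmap w) (w.1 x)
          (le_self_add.trans (hosc.trans (min_le_left _ _)))
        rw [← ENNReal.rpow_mul, mul_one_div_cancel hp0.ne', ENNReal.rpow_one] at h1
        rw [Lp.norm_def]
        refine ENNReal.toReal_le_of_le_ofReal hε.le (le_of_eq_of_le (eLpNorm_congr_ae ?_) h1)
        filter_upwards [Lp.coeFn_sub (rescale p q x (hr m) hmap w).1 W.1,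
          Lp.coeFn_const p (volume.restrict (unitBall n : Set (Pt n))) (w.1 x)] with y h2 h3
        refine h2.trans ?_
        rw [Pi.sub_apply, h3]
        rfl
      · have h1 := eLpNorm_sub_const_of_ae_eq_comp_affine hq.le hq'.ne (hr m) hmap
          (rescale_snd_coeFn x (hr m) hmap w) (w.2 x)
          (le_add_self.trans (hosc.trans (min_le_right _ _)))
        rw [← ENNReal.rpow_mul, mul_one_div_cancel hq0.ne', ENNReal.rpow_one] at h1
        rw [Lp.norm_def]
        refine ENNReal.toReal_le_of_le_ofReal hε.le (le_of_eq_of_le (eLpNorm_congr_ae ?_) h1)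
        filter_upwards [Lp.coeFn_sub (rescale p q x (hr m) hmap w).2 W.2,
          Lp.coeFn_const q (volume.restrict (unitBall n : Set (Pt n))) (w.2 x)] with y h2 h3
        refine h2.trans ?_
        rw [Pi.sub_apply, h3]
        rfl
  choose Z U hZD hZR hUW hcurl hdiv hℓ using step
  have hlim : Tendsto (fun j : ℕ => ENNReal.ofReal (1 / ((j : ℝ) + 1))) atTop (𝓝 0) := by
    have := ENNReal.tendsto_ofReal tendsto_one_div_add_atTop_nhds_zero_nat
    rwa [ENNReal.ofReal_zero] at this
  have hconv : DivCurlTendsto Z W := by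
    refine divCurlTendsto_of_approx hZR (U := U) ?_ ?_ ?_ (denseRange_denseSeq _) ?_
    · rw [tendsto_iff_norm_sub_tendsto_zero]
      exact squeeze_zero (fun _ => norm_nonneg _) hUW tendsto_one_div_add_atTop_nhds_zero_nat
    · exact tendsto_of_tendsto_of_tendsto_of_le_of_le tendsto_const_nhds hlim
        (fun _ => zero_le) hcurl
    · exact tendsto_of_tendsto_of_tendsto_of_le_of_le tendsto_const_nhds hlim
        (fun _ => zero_le) hdiv
    · rintro _ ⟨i, rfl⟩
      refine squeeze_zero_norm' ?_ tendsto_one_div_add_atTop_nhds_zero_nat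
      filter_upwards [eventually_ge_atTop i] with j hj
      exact hℓ j i hj
  refine hD (unitBall n) ⟨0, Metric.mem_ball_self one_pos⟩ Metric.isBounded_ball _ _ Z W ?_ hZD hconv
  filter_upwards [Lp.coeFn_const p (volume.restrict (unitBall n : Set (Pt n))) (w.1 x),
    Lp.coeFn_const q (volume.restrict (unitBall n : Set (Pt n))) (w.2 x)] with y h1 h2
  exact ⟨h1, h2⟩

end Localization

end DivCurl

end

theorem mainTheorem4 (n : ℕ) (p q : ℝ≥0∞) [Fact (1 ≤ p)] [Fact (1 ≤ q)]
    (hp : 1 < p) (hp' : p < ∞) (hq : 1 < q) (hq' : q < ∞) (hpq : 1 / p + 1 / q = 1)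
    (Ω : Opens (DivCurl.Pt n)) (hne : (Ω : Set (DivCurl.Pt n)).Nonempty)
    (hbd : Bornology.IsBounded (Ω : Set (DivCurl.Pt n)))
    (Dloc : Set (DivCurl.Mat n × DivCurl.Mat n)) :
    DivCurl.IsDivCurlClosed (DivCurl.dataSet p q Ω Dloc) ↔
      DivCurl.IsLocallyDivCurlClosed p q Dloc := by
  exact ⟨DivCurl.isLocallyDivCurlClosed_of_isDivCurlClosed hne hbd,
    DivCurl.isDivCurlClosed_of_isLocallyDivCurlClosed hp hp' hq hq'⟩
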